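/- **Setting.** Let $(G,H,\alpha,\tau)$ be a Lie crossed module: $G,H$ are Lie groups, $\tau:H\to G$ is a smooth homomorphism, $\alpha:G\to\mathrm{Aut}(H)$ is a homomorphism with $(g,h)\mapsto\alpha(g)h$ smooth, and $\tau(\alpha(g)h)=g\tau(h)g^{-1}$, $\alpha(\tau(h))h'=hh'h^{-1}$. Let $\mathbf K$ be its categorical group: the objects are the elements of $G$; a morphism $a\to b$ is a pair $(h,a)$ with $h\in H$ and $\tau(h)a=b$; composition is $(h_2,b)\circ(h_1,a)=(h_2h_1,a)$; the group law on objects is that of $G$, and on morphisms it is $(h,a)(k,c)=(h\,\alpha(a)(k),ac)$. Let $\pi:P\to M$ be a smooth principal $G$-bundle and $\bar A$ a connection form on it. *Paths.* Paths are piecewise $C^1$ maps on compact intervals (one-point intervals are allowed). Two paths $c_1,c_2$ in a manifold are elementarily backtrack equivalent if, after reparametrizing each by a strictly increasing piecewise $C^1$ map of a closed interval onto its domain, one of them is $a\,d\,d^{-1}\,b$ and the other is $ab$ for some paths $a,b,d$, where juxtaposition is concatenation and $d^{-1}$ is the reverse of $d$. Backtrack equivalence is the equivalence relation this generates, and a backtrack-erased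 path is an equivalence class. Let $\mathbb P^{\rm bt}(M)$ be the category whose objects are the points of $M$ and whose morphisms are the backtrack-erased paths on $M$, composed by concatenation. *Decorated paths.* Let $\mathbb P^{\rm bt}(P)^{\rm dec}_{\bar A}$ be the category whose objects are the points of $P$ and whose morphisms are the pairs $(\tilde\gamma,h)$, where $\tilde\gamma$ is the backtrack equivalence class of an $\bar A$-horizontal path on $P$ and $h\in H$, with source $s(\tilde\gamma)$, target $t(\tilde\gamma)\tau(h^{-1})$ and composition $$(\tilde\gamma_2,h_2)\circ(\tilde\gamma_1,h_1)=\bigl(\tilde\gamma_2\tau(h_1)\circ\tilde\gamma_1,\;h_2h_1\bigr).$$ **Theorem.** The assignments $p\mapsto\pi(p)$, $(\tilde\gamma,h)\mapsto\pi\circ\tilde\gamma$ define a functor $\pi:\mathbb P^{\rm bt}(P)^{\rm dec}_{\bar A}\to\mathbb P^{\rm bt}(M)$, and $$(p,g)\mapsto pg,\qquad \bigl((\tilde\gamma,h),(h_1,g_1)\bigr)\mapsto\bigl(\tilde\gamma g_1,\ \alpha(g_1^{-1})(h_1^{-1}h)\bigr)$$ define a functor $\mathbb P^{\rm bt}(P)^{\rm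 dec}_{\bar A}\times\mathbf K\to\mathbb P^{\rm bt}(P)^{\rm dec}_{\bar A}$. Together they form a principal categorical bundle, that is: $\pi$ is surjective on objects and on morphisms; the second functor is a right action of the group of objects of $\mathbf K$ on the objects and a right action of the group of morphisms of $\mathbf K$ on the morphisms; both actions are free; and they preserve, and act transitively on, the fibers of $\pi$ over each object and over each morphism of $\mathbb P^{\rm bt}(M)$. -/

import Mathlib

open CategoryTheory
open scoped Manifold ContDiff

noncomputable section

namespace CatBundle

/-! ### Categorical groups, right actions, principal categorical bundles

The set of all morphisms of a category `C` is `Arrow C`. -/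

/-- A categorical group: a category `K` with a bifunctor `⊗ : K × K ⥤ K` that is a group operation
both on the set of objects and on the set of morphisms. -/
class CategoricalGroup (K : Type*) [Category K] [Group K] [Group (Arrow K)] where
  tensor : K × K ⥤ K
  tensor_obj : ∀ a b : K, tensor.obj (a, b) = a * b
  tensor_map : ∀ f g : Arrow K, Arrow.mk (tensor.map (Prod.mkHom f.hom g.hom)) = f * g

/-- The map `Mor P × Mor K → Mor P` given by a functor `P × K ⥤ P`. -/
def actMor {P K : Type*} [Category P] [Category K] (ρ : P × K ⥤ P)
    (F : Arrow P) (φ : Arrow K) : Arrow P :=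
  Arrow.mk (ρ.map (Prod.mkHom F.hom φ.hom))

/-- A functor `ρ : P × K ⥤ P` is a right action of the categorical group `K` on `P` if it is a
right action of groups on the objects and on the morphisms. -/
structure IsRightAction {P K : Type*} [Category P] [Category K] [Group K] [Group (Arrow K)]
    [CategoricalGroup K] (ρ : P × K ⥤ P) : Prop where
  obj_one : ∀ p : P, ρ.obj (p, 1) = p
  obj_mul : ∀ (p : P) (a b : K), ρ.obj (ρ.obj (p, a), b) = ρ.obj (p, a * b)
  mor_one : ∀ F : Arrow P, actMor ρ F 1 = F
  mor_mul : ∀ (F : Arrow P) (φ ψ : Arrow K), actMor ρ (actMor ρ F φ) ψ = actMor ρ F (φ * ψ)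

/-- A principal categorical bundle: a functor `π : P ⥤ B` surjective on objects and morphisms, and
a right action of a categorical group `K` on `P`, free on objects and morphisms, which preserves
the fibers of `π` over objects and over morphisms and is transitive on each of them. -/
structure IsPrincipalCategoricalBundle {P B K : Type*} [Category P] [Category B] [Category K]
    [Group K] [Group (Arrow K)] [CategoricalGroup K] (π : P ⥤ B) (ρ : P × K ⥤ P) : Prop where
  rightAction : IsRightAction ρ
  obj_surjective : Function.Surjective π.obj
  mor_surjective : Function.Surjective π.mapArrow.obj
  obj_free : ∀ (p : P) (a : K), ρ.obj (p, a) = p → a = 1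
  mor_free : ∀ (F : Arrow P) (φ : Arrow K), actMor ρ F φ = F → φ = 1
  obj_fiber : ∀ (p : P) (a : K), π.obj (ρ.obj (p, a)) = π.obj p
  mor_fiber : ∀ (F : Arrow P) (φ : Arrow K), π.mapArrow.obj (actMor ρ F φ) = π.mapArrow.obj F
  obj_transitive : ∀ p q : P, π.obj p = π.obj q → ∃ a : K, ρ.obj (p, a) = q
  mor_transitive : ∀ F F' : Arrow P, π.mapArrow.obj F = π.mapArrow.obj F' →
    ∃ φ : Arrow K, actMor ρ F φ = F'

/-! ### Lie crossed modules and their categorical groups -/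

/-- A Lie crossed module `(G, H, α, τ)`. -/
structure LieCrossedModule (EG EH G H : Type*)
    [NormedAddCommGroup EG] [NormedSpace ℝ EG] [NormedAddCommGroup EH] [NormedSpace ℝ EH]
    [TopologicalSpace G] [ChartedSpace EG G] [Group G]
    [TopologicalSpace H] [ChartedSpace EH H] [Group H] where
  τ : H →* G
  α : G →* MulAut H
  τ_α : ∀ (g : G) (h : H), τ (α g h) = g * τ h * g⁻¹
  α_τ : ∀ h h' : H, α (τ h) h' = h * h' * h⁻¹
  contMDiff_τ : ContMDiff 𝓘(ℝ, EH) 𝓘(ℝ, EG) ∞ τ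
  contMDiff_α : ContMDiff (𝓘(ℝ, EG).prod 𝓘(ℝ, EH)) 𝓘(ℝ, EH) ∞ (fun x : G × H => α x.1 x.2)

section CrossedModule

variable {EG EH G H : Type*}
  [NormedAddCommGroup EG] [NormedSpace ℝ EG] [NormedAddCommGroup EH] [NormedSpace ℝ EH]
  [TopologicalSpace G] [ChartedSpace EG G] [Group G]
  [TopologicalSpace H] [ChartedSpace EH H] [Group H]

/-- The object set `G` of the category of a crossed module. -/
@[nolint unusedArguments]
def LieCrossedModule.Cat (_ : LieCrossedModule EG EH G H) : Type _ := G

variable (X : LieCrossedModule EG EH G H)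

instance : Group X.Cat := inferInstanceAs (Group G)

/-- An element of `X.Cat` seen as an element of `G`. -/
def LieCrossedModule.Cat.toGroup {X : LieCrossedModule EG EH G H} (a : X.Cat) : G := a

/-- A morphism `a ⟶ b` is an `h : H` with `τ(h) a = b`; this is the pair `(h, a)`.
The composite of `(h₁, a)` followed by `(h₂, b)` is `(h₂ h₁, a)`. -/
instance : Category X.Cat where
  Hom a b := {h : H // X.τ h * a.toGroup = b.toGroup}
  id a := ⟨1, by simp⟩
  comp f g := ⟨g.1 * f.1, by rw [map_mul, mul_assoc, f.2, g.2]⟩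
  id_comp f := Subtype.ext (mul_one f.1)
  comp_id f := Subtype.ext (one_mul f.1)
  assoc f g k := Subtype.ext (mul_assoc k.1 g.1 f.1).symm

/-- The product `(h, a) (k, c) = (h α(a)(k), a c)` of morphisms. -/
def LieCrossedModule.mulHom {a b c d : X.Cat} (f : a ⟶ b) (g : c ⟶ d) : a * c ⟶ b * d :=
  ⟨f.1 * X.α a.toGroup g.1, by
    obtain ⟨f, hf⟩ := f
    obtain ⟨g, hg⟩ := g
    change X.τ (f * X.α a.toGroup g) * (a.toGroup * c.toGroup) = b.toGroup * d.toGroup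
    rw [← hf, ← hg, map_mul, X.τ_α]
    group⟩

theorem LieCrossedModule.arrow_ext {f g : Arrow X.Cat} (h₁ : f.left = g.left)
    (h₂ : f.hom.1 = g.hom.1) : f = g := by
  obtain ⟨a, b, f⟩ := f
  obtain ⟨a', b', g⟩ := g
  obtain ⟨f, hf⟩ := f
  obtain ⟨g, hg⟩ := g
  dsimp at h₁ h₂
  subst h₁ h₂
  have hb : b = b' := hf.symm.trans hg
  subst hb
  rfl

instance : Group (Arrow X.Cat) where
  mul f g := Arrow.mk (X.mulHom f.hom g.hom)
  one := Arrow.mk (𝟙 (1 : X.Cat))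
  inv f := Arrow.mk (X := (f.left⁻¹ : X.Cat)) (Y := (f.right⁻¹ : X.Cat))
    ⟨X.α (f.left.toGroup)⁻¹ f.hom.1⁻¹, by
      obtain ⟨h, hf⟩ := f.hom
      change X.τ (X.α (f.left.toGroup)⁻¹ h⁻¹) * (f.left.toGroup)⁻¹ = (f.right.toGroup)⁻¹
      rw [← hf, X.τ_α, map_inv]
      group⟩
  mul_assoc f g k := X.arrow_ext (mul_assoc (G := X.Cat) f.left g.left k.left) (by
    change f.hom.1 * X.α f.left.toGroup g.hom.1 *
        X.α (f.left.toGroup * g.left.toGroup) k.hom.1 =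
      f.hom.1 * X.α f.left.toGroup (g.hom.1 * X.α g.left.toGroup k.hom.1)
    simp [mul_assoc])
  one_mul f := X.arrow_ext (one_mul (M := X.Cat) f.left) (by
    change 1 * X.α (1 : G) f.hom.1 = f.hom.1
    simp)
  mul_one f := X.arrow_ext (mul_one (M := X.Cat) f.left) (by
    change f.hom.1 * X.α f.left.toGroup 1 = f.hom.1
    simp)
  inv_mul_cancel f := X.arrow_ext (inv_mul_cancel (G := X.Cat) f.left) (by
    change X.α (f.left.toGroup)⁻¹ f.hom.1⁻¹ * X.α (f.left.toGroup)⁻¹ f.hom.1 = 1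
    rw [← map_mul]
    simp)

/-- The categorical group of the crossed module. -/
instance : CategoricalGroup X.Cat where
  tensor :=
    { obj := fun x => x.1 * x.2
      map := fun f => X.mulHom f.1 f.2
      map_id := fun x => Subtype.ext (by
        change 1 * X.α x.1.toGroup 1 = 1
        simp)
      map_comp := fun {x y z} f g => Subtype.ext (by
        have hf : y.1.toGroup = X.τ f.1.1 * x.1.toGroup := f.1.2.symm
        have key : X.α y.1.toGroup g.2.1 =
            f.1.1 * X.α x.1.toGroup g.2.1 * f.1.1⁻¹ := by
          rw [congrArg (X.α) hf, map_mul X.α, MulAut.mul_apply, X.α_τ]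
        change g.1.1 * f.1.1 * X.α x.1.toGroup (g.2.1 * f.2.1) =
          g.1.1 * X.α y.1.toGroup g.2.1 * (f.1.1 * X.α x.1.toGroup f.2.1)
        rw [key, map_mul]
        group) }
  tensor_obj _ _ := rfl
  tensor_map _ _ := rfl

end CrossedModule

/-! ### Piecewise `C¹` paths and backtrack equivalence -/

section Paths

variable {E X : Type*} [NormedAddCommGroup E] [NormedSpace ℝ E]
  [TopologicalSpace X] [ChartedSpace E X]

/-- `f` is piecewise `C¹` on `[a, b]`: apart from finitely many points, it is `C¹` on every closed
subinterval whose interior avoids these points. -/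
def PiecewiseC1 (E : Type*) {X : Type*} [NormedAddCommGroup E] [NormedSpace ℝ E]
    [TopologicalSpace X] [ChartedSpace E X] (f : ℝ → X) (a b : ℝ) : Prop :=
  ∃ S : Finset ℝ, ∀ u v : ℝ, a ≤ u → v ≤ b → (∀ s ∈ S, s ∉ Set.Ioo u v) →
    ContMDiffOn 𝓘(ℝ, ℝ) 𝓘(ℝ, E) 1 f (Set.Icc u v)

/-- The concatenation of `f` on `[0, a]` with `g` on `[0, b]`. -/
def glue {X : Type*} (a : ℝ) (f g : ℝ → X) (t : ℝ) : X := if t ≤ a then f t else g (t - a)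

theorem PiecewiseC1.congr {f g : ℝ → X} {a b : ℝ} (hf : PiecewiseC1 E f a b)
    (h : Set.EqOn g f (Set.Icc a b)) : PiecewiseC1 E g a b := by
  obtain ⟨S, hS⟩ := hf
  exact ⟨S, fun u v hu hv hs => (hS u v hu hv hs).congr
    fun t ht => h ⟨hu.trans ht.1, ht.2.trans hv⟩⟩

theorem PiecewiseC1.comp {E' Y : Type*} [NormedAddCommGroup E'] [NormedSpace ℝ E']
    [TopologicalSpace Y] [ChartedSpace E' Y] {F : X → Y} (hF : ContMDiff 𝓘(ℝ, E) 𝓘(ℝ, E') 1 F)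
    {f : ℝ → X} {a b : ℝ} (hf : PiecewiseC1 E f a b) : PiecewiseC1 E' (fun t => F (f t)) a b := by
  obtain ⟨S, hS⟩ := hf
  exact ⟨S, fun u v hu hv hs => hF.comp_contMDiffOn (hS u v hu hv hs)⟩

theorem PiecewiseC1.of_contMDiff {f : ℝ → X} (hf : ContMDiff 𝓘(ℝ, ℝ) 𝓘(ℝ, E) 1 f) (a b : ℝ) :
    PiecewiseC1 E f a b :=
  ⟨∅, fun _ _ _ _ _ => hf.contMDiffOn⟩

theorem PiecewiseC1.glue {f g : ℝ → X} {a b : ℝ} (hf : PiecewiseC1 E f 0 a)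
    (hg : PiecewiseC1 E g 0 b) (h : f a = g 0) :
    PiecewiseC1 E (CatBundle.glue a f g) 0 (a + b) := by
  classical
  obtain ⟨S, hS⟩ := hf
  obtain ⟨S', hS'⟩ := hg
  refine ⟨S ∪ S'.image (fun s => s + a) ∪ {a}, fun u v hu hv hs => ?_⟩
  have ha : a ∉ Set.Ioo u v := hs a (by simp)
  rcases le_or_gt v a with hva | hva
  · refine (hS u v hu hva fun s hs' => hs s (by simp [hs'])).congr fun t ht => ?_
    simp [CatBundle.glue, ht.2.trans hva]
  · have hau : a ≤ u := by
      by_contra hc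
      exact ha ⟨not_le.1 hc, hva⟩
    have h1 := hS' (u - a) (v - a) (by linarith) (by linarith) (fun s hs' hc =>
      hs (s + a) (by simp [hs']) ⟨by linarith [hc.1], by linarith [hc.2]⟩)
    have h2 : ContMDiff 𝓘(ℝ, ℝ) 𝓘(ℝ, ℝ) 1 (fun t : ℝ => t - a) :=
      (contDiff_id.sub contDiff_const).contMDiff
    refine (h1.comp h2.contMDiffOn (fun t ht => ⟨by linarith [ht.1], by linarith [ht.2]⟩)).congr
      fun t ht => ?_
    rcases (hau.trans ht.1).eq_or_lt with rfl | hlt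
    · simp [CatBundle.glue, h]
    · simp [CatBundle.glue, not_le.2 hlt]

theorem PiecewiseC1.reverse {f : ℝ → X} {a : ℝ} (hf : PiecewiseC1 E f 0 a) :
    PiecewiseC1 E (fun t => f (a - t)) 0 a := by
  classical
  obtain ⟨S, hS⟩ := hf
  refine ⟨S.image (fun s => a - s), fun u v hu hv hs => ?_⟩
  have h1 := hS (a - v) (a - u) (by linarith) (by linarith) (fun s hs' hc =>
      hs (a - s) (Finset.mem_image_of_mem _ hs') ⟨by linarith [hc.2], by linarith [hc.1]⟩)
  have h2 : ContMDiff 𝓘(ℝ, ℝ) 𝓘(ℝ, ℝ) 1 (fun t : ℝ => a - t) :=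
    (contDiff_const.sub contDiff_id).contMDiff
  exact h1.comp h2.contMDiffOn (fun t ht => ⟨by linarith [ht.2], by linarith [ht.1]⟩)

/-- A parametrized piecewise `C¹` path from `x` to `y`. By a translation of time its domain is
`[0, len]`; the values of `toFun` elsewhere are irrelevant. The domain may be a single point. -/
structure PwPath (E : Type*) {X : Type*} [NormedAddCommGroup E] [NormedSpace ℝ E]
    [TopologicalSpace X] [ChartedSpace E X] (x y : X) where
  len : ℝ
  toFun : ℝ → X
  len_nonneg : 0 ≤ len
  source : toFun 0 = x
  target : toFun len = y
  piecewiseC1 : PiecewiseC1 E toFun 0 len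

namespace PwPath

variable {x y z w : X}

theorem ext' {p q : PwPath E x y} (h₁ : p.len = q.len) (h₂ : p.toFun = q.toFun) : p = q := by
  cases p
  cases q
  cases h₁
  cases h₂
  rfl

/-- The path with a one-point domain. -/
def refl (E : Type*) {X : Type*} [NormedAddCommGroup E] [NormedSpace ℝ E]
    [TopologicalSpace X] [ChartedSpace E X] (x : X) : PwPath E x x where
  len := 0
  toFun _ := x
  len_nonneg := le_rfl
  source := rfl
  target := rfl
  piecewiseC1 := .of_contMDiff contMDiff_const 0 0

/-- The path `p` followed by the path `q`. -/
def trans (p : PwPath E x y) (q : PwPath E y z) : PwPath E x z where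
  len := p.len + q.len
  toFun := glue p.len p.toFun q.toFun
  len_nonneg := add_nonneg p.len_nonneg q.len_nonneg
  source := by simp [glue, p.len_nonneg, p.source]
  target := by
    rcases q.len_nonneg.eq_or_lt with h | h
    · have h1 := q.source
      rw [h, q.target] at h1
      simp [glue, ← h, p.target, h1]
    · simp [glue, h, q.target]
  piecewiseC1 := p.piecewiseC1.glue q.piecewiseC1 (p.target.trans q.source.symm)

/-- The reverse of a path. -/
def symm (p : PwPath E x y) : PwPath E y x where
  len := p.len
  toFun t := p.toFun (p.len - t)
  len_nonneg := p.len_nonneg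
  source := by simp [p.target]
  target := by simp [p.source]
  piecewiseC1 := p.piecewiseC1.reverse

/-- The image of a path under a `C¹` map. -/
def map {E' Y : Type*} [NormedAddCommGroup E'] [NormedSpace ℝ E']
    [TopologicalSpace Y] [ChartedSpace E' Y] {F : X → Y} (hF : ContMDiff 𝓘(ℝ, E) 𝓘(ℝ, E') 1 F)
    (p : PwPath E x y) : PwPath E' (F x) (F y) where
  len := p.len
  toFun t := F (p.toFun t)
  len_nonneg := p.len_nonneg
  source := by rw [p.source]
  target := by rw [p.target]
  piecewiseC1 := p.piecewiseC1.comp hF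

/-- `IsReparam p c` says that `p = c ∘ φ` for a strictly increasing piecewise `C¹` map `φ` of the
domain of `p` onto the domain of `c`. -/
def IsReparam (p c : PwPath E x y) : Prop :=
  ∃ φ : ℝ → ℝ, StrictMonoOn φ (Set.Icc 0 p.len) ∧ PiecewiseC1 ℝ φ 0 p.len ∧
    φ 0 = 0 ∧ φ p.len = c.len ∧ ∀ t ∈ Set.Icc 0 p.len, p.toFun t = c.toFun (φ t)

/-- Elementary backtrack equivalence: up to reparametrization, one of the paths is `a d d⁻¹ b` and
the other one is `a b`. -/
def ElemBacktrack (c₁ c₂ : PwPath E x y) : Prop :=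
  ∃ (z w : X) (a : PwPath E x z) (d : PwPath E z w) (b : PwPath E z y),
    (IsReparam (a.trans (d.trans (d.symm.trans b))) c₁ ∧ IsReparam (a.trans b) c₂) ∨
    (IsReparam (a.trans (d.trans (d.symm.trans b))) c₂ ∧ IsReparam (a.trans b) c₁)

theorem isReparam_of_eqOn {p c : PwPath E x y} (h₁ : p.len = c.len)
    (h₂ : Set.EqOn p.toFun c.toFun (Set.Icc 0 p.len)) : IsReparam p c :=
  ⟨fun t => t, fun _ _ _ _ h => h, .of_contMDiff contMDiff_id _ _, rfl, h₁, h₂⟩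

theorem IsReparam.bounds {p c : PwPath E x y} {φ : ℝ → ℝ}
    (hm : StrictMonoOn φ (Set.Icc 0 p.len)) (h₀ : φ 0 = 0) (h₁ : φ p.len = c.len) {t : ℝ}
    (ht : t ∈ Set.Icc 0 p.len) : φ t ∈ Set.Icc 0 c.len := by
  constructor
  · rw [← h₀]
    exact hm.monotoneOn ⟨le_rfl, p.len_nonneg⟩ ht ht.1
  · rw [← h₁]
    exact hm.monotoneOn ht ⟨p.len_nonneg, le_rfl⟩ ht.2

theorem IsReparam.trans {p c : PwPath E x y} {q d : PwPath E y z} (h : IsReparam p c)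
    (h' : IsReparam q d) : IsReparam (p.trans q) (c.trans d) := by
  obtain ⟨φ, hm, hφ, h0, h1, he⟩ := h
  obtain ⟨ψ, hm', hψ, h0', h1', he'⟩ := h'
  have bφ := fun {t} ht => IsReparam.bounds (p := p) (c := c) hm h0 h1 (t := t) ht
  have pos : ∀ {s}, s ∈ Set.Icc 0 q.len → 0 < s → 0 < ψ s := fun {s} hs h => by
    rw [← h0']
    exact hm' ⟨le_rfl, q.len_nonneg⟩ hs h
  have mem : ∀ {t}, t ∈ Set.Icc 0 (p.len + q.len) → p.len < t → t - p.len ∈ Set.Icc 0 q.len :=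
    fun {t} ht h => ⟨by linarith, by linarith [ht.2]⟩
  refine ⟨glue p.len φ (fun t => c.len + ψ t), ?_, ?_, ?_, ?_, ?_⟩
  · intro s hs t ht hst
    change s ∈ Set.Icc 0 (p.len + q.len) at hs
    change t ∈ Set.Icc 0 (p.len + q.len) at ht
    by_cases hs' : s ≤ p.len <;> by_cases ht' : t ≤ p.len
    · simpa [glue, hs', ht'] using hm ⟨hs.1, hs'⟩ ⟨ht.1, ht'⟩ hst
    · have a1 := (bφ ⟨hs.1, hs'⟩).2
      have a2 := pos (mem ht (not_le.1 ht')) (by linarith)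
      simp only [glue, hs', ht', if_true, if_false]
      linarith
    · exact absurd (hst.le.trans ht') hs'
    · simpa [glue, hs', ht'] using
        hm' (mem hs (not_le.1 hs')) (mem ht (not_le.1 ht')) (by linarith)
  · refine PiecewiseC1.glue hφ (hψ.comp (F := fun t => c.len + t) ?_) (by simp [h1, h0'])
    exact (contDiff_const.add contDiff_id).contMDiff
  · simp [glue, p.len_nonneg, h0]
  · change glue p.len φ (fun t => c.len + ψ t) (p.len + q.len) = c.len + d.len
    rcases q.len_nonneg.eq_or_lt with h | h
    · have : d.len = 0 := by rw [← h1', ← h, h0']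
      simp [glue, ← h, h1, this]
    · simp [glue, h, h1']
  · intro t ht
    change t ∈ Set.Icc 0 (p.len + q.len) at ht
    change glue p.len p.toFun q.toFun t = glue c.len c.toFun d.toFun (glue p.len φ _ t)
    by_cases ht' : t ≤ p.len
    · simp [glue, ht', (bφ ⟨ht.1, ht'⟩).2, he t ⟨ht.1, ht'⟩]
    · have a1 := mem ht (not_le.1 ht')
      have a2 := pos a1 (by linarith)
      simp [glue, ht', a2, he' _ a1]

theorem trans_assoc (p : PwPath E x y) (q : PwPath E y z) (r : PwPath E z w) :
    (p.trans q).trans r = p.trans (q.trans r) := by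
  refine ext' (add_assoc _ _ _) (funext fun t => ?_)
  have hq := q.len_nonneg
  simp only [trans, glue]
  by_cases h1 : t ≤ p.len
  · have h2 : t ≤ p.len + q.len := by linarith
    simp [h1, h2]
  · by_cases h2 : t ≤ p.len + q.len
    · have h3 : t - p.len ≤ q.len := by linarith
      simp [h1, h2, h3]
    · have h3 : ¬ t - p.len ≤ q.len := by intro h; exact h2 (by linarith)
      simp [h1, h2, h3, sub_sub]

theorem isReparam_refl_trans (p : PwPath E x y) : IsReparam ((refl E x).trans p) p := by
  refine isReparam_of_eqOn (zero_add _) fun t ht => ?_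
  rcases ht.1.eq_or_lt with rfl | h
  · simp [trans, refl, glue, p.source]
  · simp [trans, refl, glue, h]

theorem isReparam_trans_refl (p : PwPath E x y) : IsReparam (p.trans (refl E y)) p := by
  refine isReparam_of_eqOn (add_zero _) fun t ht => ?_
  have : t ≤ p.len := by simpa [trans, refl] using ht.2
  simp [trans, glue, this]

theorem isReparam_self (p : PwPath E x y) : IsReparam p p :=
  isReparam_of_eqOn rfl fun _ _ => rfl

theorem IsReparam.comp {p q r : PwPath E x y} (h : IsReparam p q) (h' : q.len = r.len)
    (h'' : Set.EqOn q.toFun r.toFun (Set.Icc 0 q.len)) : IsReparam p r := by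
  obtain ⟨φ, hm, hφ, h0, h1, he⟩ := h
  exact ⟨φ, hm, hφ, h0, h1.trans h', fun t ht =>
    (he t ht).trans (h'' (IsReparam.bounds hm h0 h1 ht))⟩

/-- A path is backtrack equivalent to each of its reparametrizations. -/
theorem ElemBacktrack.of_isReparam {p c : PwPath E x y} (h : IsReparam p c) :
    ElemBacktrack p c := by
  refine ⟨x, x, refl E x, refl E x, p, Or.inl ⟨?_, ?_⟩⟩
  · have h1 : (refl E x).symm = refl E x := ext' rfl rfl
    rw [h1]
    refine isReparam_of_eqOn (by simp [trans, refl]) fun t ht => ?_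
    rcases ht.1.eq_or_lt with rfl | h
    · simp [trans, refl, glue, p.source]
    · simp [trans, refl, glue, not_le.2 h]
  · obtain ⟨φ, hm, hφ, h0, h1, he⟩ := h
    have hl : ((refl E x).trans p).len = p.len := by simp [trans, refl]
    refine ⟨φ, by rwa [hl], by rwa [hl], h0, by rwa [hl], fun t ht => ?_⟩
    rw [hl] at ht
    rw [← he t ht]
    rcases ht.1.eq_or_lt with rfl | h
    · simp [trans, refl, glue, p.source]
    · simp [trans, refl, glue, h]

theorem ElemBacktrack.trans_left {c₁ c₂ : PwPath E x y} (h : ElemBacktrack c₁ c₂)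
    (e : PwPath E y z) : ElemBacktrack (c₁.trans e) (c₂.trans e) := by
  obtain ⟨u, v, a, d, b, h⟩ := h
  refine ⟨u, v, a, d, b.trans e, ?_⟩
  simp only [← trans_assoc] at h ⊢
  exact h.imp (fun h => ⟨h.1.trans (isReparam_self e), h.2.trans (isReparam_self e)⟩)
    (fun h => ⟨h.1.trans (isReparam_self e), h.2.trans (isReparam_self e)⟩)

theorem ElemBacktrack.trans_right {c₁ c₂ : PwPath E y z} (h : ElemBacktrack c₁ c₂)
    (e : PwPath E x y) : ElemBacktrack (e.trans c₁) (e.trans c₂) := by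
  obtain ⟨u, v, a, d, b, h⟩ := h
  refine ⟨u, v, e.trans a, d, b, ?_⟩
  simp only [trans_assoc e]
  exact h.imp (fun h => ⟨(isReparam_self e).trans h.1, (isReparam_self e).trans h.2⟩)
    (fun h => ⟨(isReparam_self e).trans h.1, (isReparam_self e).trans h.2⟩)

theorem map_trans {E' Y : Type*} [NormedAddCommGroup E'] [NormedSpace ℝ E']
    [TopologicalSpace Y] [ChartedSpace E' Y] {F : X → Y} (hF : ContMDiff 𝓘(ℝ, E) 𝓘(ℝ, E') 1 F)
    (p : PwPath E x y) (q : PwPath E y z) : (p.trans q).map hF = (p.map hF).trans (q.map hF) :=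
  ext' rfl (funext fun t => by simp only [map, trans, glue]; split_ifs <;> rfl)

theorem ElemBacktrack.map {E' Y : Type*} [NormedAddCommGroup E'] [NormedSpace ℝ E']
    [TopologicalSpace Y] [ChartedSpace E' Y] {F : X → Y} (hF : ContMDiff 𝓘(ℝ, E) 𝓘(ℝ, E') 1 F)
    {c₁ c₂ : PwPath E x y} (h : ElemBacktrack c₁ c₂) :
    ElemBacktrack (c₁.map hF) (c₂.map hF) := by
  have key : ∀ {p c : PwPath E x y}, IsReparam p c → IsReparam (p.map hF) (c.map hF) := by
    rintro p c ⟨φ, hm, hφ, h0, h1, he⟩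
    exact ⟨φ, hm, hφ, h0, h1, fun t ht => congrArg F (he t ht)⟩
  obtain ⟨u, v, a, d, b, h⟩ := h
  refine ⟨F u, F v, a.map hF, d.map hF, b.map hF, ?_⟩
  have h1 : (d.map hF).symm = d.symm.map hF := rfl
  simp only [h1, ← map_trans]
  exact h.imp (fun h => ⟨key h.1, key h.2⟩) (fun h => ⟨key h.1, key h.2⟩)

/-- Backtrack equivalence of paths: the equivalence relation generated by elementary backtrack
equivalence. -/
def btSetoid (x y : X) : Setoid (PwPath E x y) := Relation.EqvGen.setoid ElemBacktrack

theorem eqvGen_map {α β : Type*} {r : α → α → Prop} {s : β → β → Prop} (f : α → β)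
    (hf : ∀ a b, r a b → s (f a) (f b)) {a b : α} (h : Relation.EqvGen r a b) :
    Relation.EqvGen s (f a) (f b) := by
  induction h with
  | rel _ _ h => exact .rel _ _ (hf _ _ h)
  | refl _ => exact .refl _
  | symm _ _ _ ih => exact .symm _ _ ih
  | trans _ _ _ _ _ ih ih' => exact .trans _ _ _ ih ih'

end PwPath

/-! ### The category of backtrack-erased paths -/

/-- The objects of the category of backtrack-erased piecewise `C¹` paths on a manifold `X`
modelled on `E`: the points of `X`. -/
@[nolint unusedArguments]
def PathCat (_E X : Type*) : Type _ := X

/-- A backtrack-erased path from `x` to `y`: a backtrack equivalence class of paths. -/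
def BtPath (E : Type*) {X : Type*} [NormedAddCommGroup E] [NormedSpace ℝ E]
    [TopologicalSpace X] [ChartedSpace E X] (x y : X) : Type _ :=
  Quotient (PwPath.btSetoid (E := E) x y)

/-- The class of a path. -/
def BtPath.mk {x y : X} (p : PwPath E x y) : BtPath E x y := Quotient.mk _ p

/-- Composition of backtrack-erased paths: the class of the concatenation. -/
def BtPath.trans {x y z : X} (p : BtPath E x y) (q : BtPath E y z) : BtPath E x z :=
  Quotient.map₂ PwPath.trans (fun _ b h c _ h' => Relation.EqvGen.trans _ _ _
    (PwPath.eqvGen_map (fun p => PwPath.trans p c) (fun _ _ h => h.trans_left c) h)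
    (PwPath.eqvGen_map (fun p => PwPath.trans b p) (fun _ _ h => h.trans_right b) h')) p q

/-- The image of a backtrack-erased path under a `C¹` map. -/
def BtPath.map {E' Y : Type*} [NormedAddCommGroup E'] [NormedSpace ℝ E']
    [TopologicalSpace Y] [ChartedSpace E' Y] {F : X → Y} (hF : ContMDiff 𝓘(ℝ, E) 𝓘(ℝ, E') 1 F)
    {x y : X} (p : BtPath E x y) : BtPath E' (F x) (F y) :=
  Quotient.map (PwPath.map hF) (fun _ _ h => PwPath.eqvGen_map _ (fun _ _ h => h.map hF) h) p

/-- The category of backtrack-erased paths on `X`. -/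
instance : Category (PathCat E X) where
  Hom x y := BtPath E (X := X) x y
  id x := BtPath.mk (PwPath.refl E (X := X) x)
  comp p q := BtPath.trans p q
  id_comp p := by
    induction p using Quotient.inductionOn with
    | h p => exact Quotient.sound (.rel _ _ (.of_isReparam (PwPath.isReparam_refl_trans p)))
  comp_id p := by
    induction p using Quotient.inductionOn with
    | h p => exact Quotient.sound (.rel _ _ (.of_isReparam (PwPath.isReparam_trans_refl p)))
  assoc p q r := by
    induction p using Quotient.inductionOn with
    | h p =>
      induction q using Quotient.inductionOn with
      | h q =>
        induction r using Quotient.inductionOn with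
        | h r => exact congrArg BtPath.mk (PwPath.trans_assoc p q r)

/-- The functor on categories of backtrack-erased paths induced by a `C¹` map. -/
def PathCat.map {E' Y : Type*} [NormedAddCommGroup E'] [NormedSpace ℝ E']
    [TopologicalSpace Y] [ChartedSpace E' Y] {F : X → Y} (hF : ContMDiff 𝓘(ℝ, E) 𝓘(ℝ, E') 1 F) :
    PathCat E X ⥤ PathCat E' Y where
  obj x := F x
  map p := BtPath.map hF p
  map_id _ := rfl
  map_comp p q := by
    induction p using Quotient.inductionOn with
    | h p =>
      induction q using Quotient.inductionOn with
      | h q => exact congrArg BtPath.mk (PwPath.map_trans hF p q)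

end Paths

/-! ### Principal bundles, connections, horizontal paths -/

/-- A smooth principal `G`-bundle `P → M`, with `p g` written as `act p g`. -/
structure PrincipalBundle (EG EP EM G P M : Type*)
    [NormedAddCommGroup EG] [NormedSpace ℝ EG] [NormedAddCommGroup EP] [NormedSpace ℝ EP]
    [NormedAddCommGroup EM] [NormedSpace ℝ EM]
    [TopologicalSpace G] [ChartedSpace EG G] [Group G]
    [TopologicalSpace P] [ChartedSpace EP P] [TopologicalSpace M] [ChartedSpace EM M] where
  proj : P → M
  act : P → G → P
  contMDiff_proj : ContMDiff 𝓘(ℝ, EP) 𝓘(ℝ, EM) ∞ proj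
  proj_surjective : Function.Surjective proj
  contMDiff_act :
    ContMDiff (𝓘(ℝ, EP).prod 𝓘(ℝ, EG)) 𝓘(ℝ, EP) ∞ (fun x : P × G => act x.1 x.2)
  act_one : ∀ p, act p 1 = p
  act_mul : ∀ p g h, act (act p g) h = act p (g * h)
  act_free : ∀ p g, act p g = p → g = 1
  proj_act : ∀ p g, proj (act p g) = proj p
  /-- Every point of `M` has an open neighbourhood `U` with an equivariant diffeomorphism
  `φ : U × G → π⁻¹(U)` over `U`. -/
  locally_trivial : ∀ x : M, ∃ (U : Set M) (φ : PartialEquiv (M × G) P),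
    IsOpen U ∧ x ∈ U ∧ φ.source = U ×ˢ Set.univ ∧ φ.target = proj ⁻¹' U ∧
    ContMDiffOn (𝓘(ℝ, EM).prod 𝓘(ℝ, EG)) 𝓘(ℝ, EP) ∞ φ φ.source ∧
    ContMDiffOn 𝓘(ℝ, EP) (𝓘(ℝ, EM).prod 𝓘(ℝ, EG)) ∞ φ.symm φ.target ∧
    ∀ u ∈ U, ∀ g h : G, proj (φ (u, g)) = u ∧ act (φ (u, g)) h = φ (u, g * h)

section Bundle

variable {EG EP EM G P M : Type*}
  [NormedAddCommGroup EG] [NormedSpace ℝ EG] [NormedAddCommGroup EP] [NormedSpace ℝ EP]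
  [NormedAddCommGroup EM] [NormedSpace ℝ EM]
  [TopologicalSpace G] [ChartedSpace EG G] [Group G]
  [TopologicalSpace P] [ChartedSpace EP P] [TopologicalSpace M] [ChartedSpace EM M]

/-- The right translation by `g` is smooth. -/
theorem PrincipalBundle.contMDiff_translate (B : PrincipalBundle EG EP EM G P M) (g : G) :
    ContMDiff 𝓘(ℝ, EP) 𝓘(ℝ, EP) ∞ (fun p => B.act p g) :=
  B.contMDiff_act.comp (contMDiff_id.prodMk contMDiff_const)

/-- The functor on backtrack-erased paths on `P` given by right translation by `g`. -/
def PrincipalBundle.translate (B : PrincipalBundle EG EP EM G P M) (g : G) :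
    PathCat EP P ⥤ PathCat EP P :=
  PathCat.map ((B.contMDiff_translate g).of_le (by exact_mod_cast le_top))

/-- The functor on backtrack-erased paths given by the projection `P → M`. -/
def PrincipalBundle.projPath (B : PrincipalBundle EG EP EM G P M) :
    PathCat EP P ⥤ PathCat EM M :=
  PathCat.map (B.contMDiff_proj.of_le (by exact_mod_cast le_top))

/-- The adjoint representation of `G` on its Lie algebra: the derivative at `1` of conjugation. -/
def Ad (EG : Type*) {G : Type*} [NormedAddCommGroup EG] [NormedSpace ℝ EG]
    [TopologicalSpace G] [ChartedSpace EG G] [Group G] (g : G) (Y : GroupLieAlgebra 𝓘(ℝ, EG) G) :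
    GroupLieAlgebra 𝓘(ℝ, EG) G :=
  mfderiv 𝓘(ℝ, EG) 𝓘(ℝ, EG) (fun x : G => g * x * g⁻¹) 1 Y

variable [IsManifold 𝓘(ℝ, EP) ∞ P]

/-- A connection form on a principal bundle: a smooth `1`-form on `P` with values in the Lie
algebra of `G`, equivariant, and reproducing the generators of the fundamental vertical vector
fields. The vector at `p` of the fundamental field of `Y` is the derivative at `1` in the
direction `Y` of `g ↦ p g`. -/
structure Connection (B : PrincipalBundle EG EP EM G P M) where
  form : ∀ p : P, TangentSpace 𝓘(ℝ, EP) p →L[ℝ] GroupLieAlgebra 𝓘(ℝ, EG) G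
  contMDiff_form : ContMDiff (M' := EG) (𝓘(ℝ, EP).tangent) 𝓘(ℝ, EG) ∞
    (fun v : TangentBundle 𝓘(ℝ, EP) P => form v.1 v.2)
  equivariant : ∀ (p : P) (g : G) (v : TangentSpace 𝓘(ℝ, EP) p),
    form (B.act p g) (mfderiv 𝓘(ℝ, EP) 𝓘(ℝ, EP) (fun q => B.act q g) p v) = Ad EG g⁻¹ (form p v)
  vertical : ∀ (p : P) (Y : GroupLieAlgebra 𝓘(ℝ, EG) G),
    form (B.act p 1) (mfderiv 𝓘(ℝ, EG) 𝓘(ℝ, EP) (fun g : G => B.act p g) 1 Y) = Y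

variable {B : PrincipalBundle EG EP EM G P M} (A : Connection B)

/-- A piecewise `C¹` path on `P` is horizontal if the connection form vanishes on its velocity,
up to finitely many times. -/
def Connection.IsHorizontalPath {p q : P} (γ : PwPath EP p q) : Prop :=
  ∃ S : Finset ℝ, ∀ t ∈ Set.Ioo 0 γ.len, t ∉ S →
    A.form (γ.toFun t) (mfderiv 𝓘(ℝ, ℝ) 𝓘(ℝ, EP) γ.toFun t (1 : ℝ)) = 0

/-- A backtrack-erased horizontal path: the class of a horizontal path. -/
def Connection.IsHorizontal {p q : PathCat EP P} (f : p ⟶ q) : Prop :=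
  ∃ γ : PwPath EP (X := P) p q, A.IsHorizontalPath γ ∧ BtPath.mk γ = f

theorem Connection.isHorizontal_refl (p : PathCat EP P) : A.IsHorizontal (𝟙 p) :=
  ⟨PwPath.refl EP (X := P) p, ⟨∅, fun _ ht _ => absurd (ht.1.trans ht.2) (lt_irrefl _)⟩, rfl⟩

theorem Connection.IsHorizontal.eqToHom {p q r : PathCat EP P} {f : p ⟶ q}
    (hf : A.IsHorizontal f) (h : q = r) : A.IsHorizontal (f ≫ CategoryTheory.eqToHom h) := by
  subst h
  simpa using hf

theorem Connection.IsHorizontal.trans {p q r : PathCat EP P} {f : p ⟶ q} {g : q ⟶ r}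
    (hf : A.IsHorizontal f) (hg : A.IsHorizontal g) : A.IsHorizontal (f ≫ g) := by
  classical
  obtain ⟨γ, ⟨S, hS⟩, rfl⟩ := hf
  obtain ⟨δ, ⟨S', hS'⟩, rfl⟩ := hg
  refine ⟨γ.trans δ, ⟨S ∪ S'.image (fun s => s + γ.len) ∪ {γ.len}, fun t ht hts => ?_⟩, rfl⟩
  simp only [Finset.mem_union, Finset.mem_image, Finset.mem_singleton, not_or] at hts
  obtain ⟨⟨h1, h2⟩, h3⟩ := hts
  rcases lt_or_gt_of_ne h3 with h | h
  · have he : (γ.trans δ).toFun =ᶠ[nhds t] γ.toFun := by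
      filter_upwards [Iio_mem_nhds h] with s hs
      simp [PwPath.trans, glue, (Set.mem_Iio.1 hs).le]
    rw [he.mfderiv_eq]
    have h0 : (γ.trans δ).toFun t = γ.toFun t := he.eq_of_nhds
    have := hS t ⟨ht.1, h⟩ h1
    rw [← h0] at this
    exact this
  · have he : (γ.trans δ).toFun =ᶠ[nhds t] δ.toFun ∘ (fun s => s - γ.len) := by
      filter_upwards [Ioi_mem_nhds h] with s hs
      simp [PwPath.trans, glue, not_le.2 (Set.mem_Ioi.1 hs)]
    have hlen : t < γ.len + δ.len := ht.2
    have key := hS' (t - γ.len) ⟨by linarith, by linarith⟩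
      (fun hc => h2 ⟨t - γ.len, hc, by ring⟩)
    have h0 : (γ.trans δ).toFun t = δ.toFun (t - γ.len) := he.eq_of_nhds
    rw [he.mfderiv_eq]
    by_cases hd : MDifferentiableAt 𝓘(ℝ, ℝ) 𝓘(ℝ, EP) δ.toFun (t - γ.len)
    · have hsub : HasMFDerivAt 𝓘(ℝ, ℝ) 𝓘(ℝ, ℝ) (fun s : ℝ => s - γ.len) t
          (ContinuousLinearMap.id ℝ ℝ) :=
        ((hasFDerivAt_id t).sub_const γ.len).hasMFDerivAt
      rw [(hd.hasMFDerivAt.comp t hsub).mfderiv]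
      rw [← h0] at key
      exact key
    · have hd' : ¬ MDifferentiableAt 𝓘(ℝ, ℝ) 𝓘(ℝ, EP) (δ.toFun ∘ fun s => s - γ.len) t := by
        intro hc
        apply hd
        have hadd : MDifferentiableAt 𝓘(ℝ, ℝ) 𝓘(ℝ, ℝ) (fun s : ℝ => s + γ.len) (t - γ.len) :=
          (differentiableAt_id.add_const γ.len).mdifferentiableAt
        have hc' : MDifferentiableAt 𝓘(ℝ, ℝ) 𝓘(ℝ, EP) (δ.toFun ∘ fun s => s - γ.len)
            ((fun s : ℝ => s + γ.len) (t - γ.len)) := by simpa using hc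
        have := hc'.comp (t - γ.len) hadd
        simpa [Function.comp_def] using this
      rw [mfderiv_zero_of_not_mdifferentiableAt hd']
      exact map_zero _

theorem Connection.IsHorizontal.translate {p q : PathCat EP P} {f : p ⟶ q}
    (hf : A.IsHorizontal f) (g : G) : A.IsHorizontal ((B.translate g).map f) := by
  obtain ⟨γ, ⟨S, hS⟩, rfl⟩ := hf
  have hs : ∀ g x, MDifferentiableAt 𝓘(ℝ, EP) 𝓘(ℝ, EP) (fun p => B.act p g) x := fun g x =>
    (B.contMDiff_translate g).mdifferentiable (by simp) x
  refine ⟨PwPath.map (E := EP) (X := P) ((B.contMDiff_translate g).of_le (by exact_mod_cast le_top)) γ,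
    ⟨S, fun t ht hts => ?_⟩, rfl⟩
  have key := hS t ht hts
  change A.form (B.act (γ.toFun t) g) (mfderiv 𝓘(ℝ, ℝ) 𝓘(ℝ, EP)
    ((fun p => B.act p g) ∘ γ.toFun) t (1 : ℝ)) = 0
  by_cases hd : MDifferentiableAt 𝓘(ℝ, ℝ) 𝓘(ℝ, EP) γ.toFun t
  · rw [mfderiv_comp t (hs g _) hd]
    have := A.equivariant (γ.toFun t) g (mfderiv 𝓘(ℝ, ℝ) 𝓘(ℝ, EP) γ.toFun t (1 : ℝ))
    rw [key] at this
    exact this.trans (map_zero (mfderiv 𝓘(ℝ, EG) 𝓘(ℝ, EG) (fun x : G => g⁻¹ * x * g⁻¹⁻¹) 1))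
  · have hd' : ¬ MDifferentiableAt 𝓘(ℝ, ℝ) 𝓘(ℝ, EP) ((fun p => B.act p g) ∘ γ.toFun) t := by
      intro hc
      apply hd
      have := (hs g⁻¹ _).comp t hc
      simpa [Function.comp_def, B.act_mul, B.act_one] using this
    rw [mfderiv_zero_of_not_mdifferentiableAt hd']
    exact map_zero _

/-! ### Decorated horizontal paths -/

variable {EH H : Type*} [NormedAddCommGroup EH] [NormedSpace ℝ EH]
  [TopologicalSpace H] [ChartedSpace EH H] [Group H]

/-- The objects of the category of decorated horizontal backtrack-erased paths: the points of
`P`. -/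
@[nolint unusedArguments]
def DecCat (_ : Connection B) (_ : LieCrossedModule EG EH G H) : Type _ := P

/-- A point of `P`, as an object of the category of paths on `P`. -/
def DecCat.toPath {A : Connection B} {X : LieCrossedModule EG EH G H} (p : DecCat A X) :
    PathCat EP P := p

/-- A morphism `p ⟶ q`: a pair `(γ, h)` of a backtrack-erased horizontal path `γ` and an `h : H`
such that `γ` starts at `p` and its end point `t(γ)` satisfies `t(γ) τ(h⁻¹) = q`, which is
`t(γ) = q τ(h)`. -/
@[ext]
structure DecHom {A : Connection B} {X : LieCrossedModule EG EH G H} (p q : DecCat A X) where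
  h : H
  path : p.toPath ⟶ (B.translate (X.τ h)).obj q.toPath
  horizontal : A.IsHorizontal path

variable (X : LieCrossedModule EG EH G H)

theorem translate_obj_one (p : PathCat EP P) : (B.translate 1).obj p = p := B.act_one p

theorem translate_obj_mul (p : PathCat EP P) (g h : G) :
    (B.translate h).obj ((B.translate g).obj p) = (B.translate (g * h)).obj p := B.act_mul p g h

theorem translate_map_one {p q : PathCat EP P} (f : p ⟶ q) :
    (B.translate 1).map f = eqToHom (translate_obj_one (B := B) p) ≫ f ≫
      eqToHom (translate_obj_one (B := B) q).symm := by
  have key : ∀ (F : P → P) (hF : ContMDiff 𝓘(ℝ, EP) 𝓘(ℝ, EP) 1 F) (h : F = id),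
      (PathCat.map hF).map f = eqToHom (X := (PathCat.map hF).obj p) (congrFun h p) ≫ f ≫
        eqToHom (Y := (PathCat.map hF).obj q) (congrFun h q).symm := by
    rintro F hF rfl
    refine Eq.trans ?_ ((Category.id_comp _).trans (Category.comp_id f)).symm
    induction f using Quotient.inductionOn with
    | h f => rfl
  exact key _ _ (funext B.act_one)

theorem translate_map_mul {p q : PathCat EP P} (f : p ⟶ q) (g h : G) :
    (B.translate h).map ((B.translate g).map f) = eqToHom (translate_obj_mul p g h) ≫
      (B.translate (g * h)).map f ≫ eqToHom (translate_obj_mul q g h).symm := by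
  have key : ∀ (F F' : P → P) (hF : ContMDiff 𝓘(ℝ, EP) 𝓘(ℝ, EP) 1 F)
      (hF' : ContMDiff 𝓘(ℝ, EP) 𝓘(ℝ, EP) 1 F') (h : F = F'),
      (PathCat.map hF).map f =
        eqToHom (X := (PathCat.map hF).obj p) (Y := (PathCat.map hF').obj p) (congrFun h p) ≫
          (PathCat.map hF').map f ≫
          eqToHom (X := (PathCat.map hF').obj q) (Y := (PathCat.map hF).obj q)
            (congrFun h q).symm := by
    rintro F F' hF hF' rfl
    exact ((Category.id_comp _).trans (Category.comp_id _)).symm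
  refine Eq.trans ?_ (key (fun p => B.act (B.act p g) h) (fun p => B.act p (g * h))
    (((B.contMDiff_translate h).comp (B.contMDiff_translate g)).of_le (by exact_mod_cast le_top))
    ((B.contMDiff_translate (g * h)).of_le (by exact_mod_cast le_top))
    (funext fun p => B.act_mul p g h))
  induction f using Quotient.inductionOn with
  | h f => rfl

theorem DecHom.ext' {A : Connection B} {X : LieCrossedModule EG EH G H} {p q : DecCat A X}
    {f g : DecHom p q} (h₁ : f.h = g.h)
    (h₂ : f.path ≫ eqToHom (by rw [h₁]) = g.path) : f = g := by
  obtain ⟨h, f, hf⟩ := f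
  obtain ⟨h', g, hg⟩ := g
  dsimp at h₁
  subst h₁
  simp only [eqToHom_refl, Category.comp_id] at h₂
  subst h₂
  rfl

/-- The composite of `(γ₁, h₁)` followed by `(γ₂, h₂)` is `(γ, h₂ h₁)`, where `γ` is `γ₁` followed
by the right translate `γ₂ τ(h₁)`. The arrows `eqToHom` only adjust the endpoints along
equalities such as `(r τ(h₂)) τ(h₁) = r τ(h₂ h₁)`. -/
def DecHom.comp {A : Connection B} {X : LieCrossedModule EG EH G H} {p q r : DecCat A X}
    (f : DecHom p q) (g : DecHom q r) : DecHom p r where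
  h := g.h * f.h
  path := f.path ≫ (B.translate (X.τ f.h)).map g.path ≫
    eqToHom (by rw [translate_obj_mul, map_mul])
  horizontal := f.horizontal.trans A ((g.horizontal.translate A _).eqToHom A _)

/-- The identity of `p` is the constant path decorated with `1`. -/
def DecHom.id {A : Connection B} {X : LieCrossedModule EG EH G H} (p : DecCat A X) :
    DecHom p p where
  h := 1
  path := 𝟙 p.toPath ≫ eqToHom (by rw [map_one, translate_obj_one])
  horizontal := (A.isHorizontal_refl _).eqToHom A _

theorem translate_congr {p q : PathCat EP P} (f : p ⟶ q) {g g' : G} (h : g = g') :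
    (B.translate g).map f = eqToHom (by rw [h]) ≫ (B.translate g').map f ≫
      eqToHom (by rw [h]) := by
  subst h
  simp

/-- The category of horizontal backtrack-erased paths on `P` decorated with elements of `H`. -/
instance : Category (DecCat A X) where
  Hom p q := DecHom p q
  id p := DecHom.id p
  comp f g := DecHom.comp f g
  id_comp f := DecHom.ext' (mul_one f.h) (by
    simp [DecHom.comp, DecHom.id, translate_congr f.path (map_one X.τ), translate_map_one]
    erw [eqToHom_trans, eqToHom_refl, Category.comp_id])
  comp_id f := DecHom.ext' (one_mul f.h) (by
    simp [DecHom.comp, DecHom.id, eqToHom_map]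
    erw [eqToHom_trans, eqToHom_refl, Category.comp_id])
  assoc f g k := DecHom.ext' (mul_assoc k.h g.h f.h).symm (by
    simp [DecHom.comp, eqToHom_map, translate_map_mul,
      translate_congr k.path (map_mul X.τ g.h f.h)]
    erw [eqToHom_trans])

/-- The projection to the base: `p ↦ π(p)` on objects, `(γ, h) ↦ π ∘ γ` on morphisms. -/
def decProj : DecCat A X ⥤q PathCat EM M where
  obj p := B.projPath.obj p.toPath
  map {_ q} f := B.projPath.map f.path ≫ eqToHom (B.proj_act (q : P) (X.τ f.h))

theorem decAct_target (q : DecCat A X) (h : H) {a b : X.Cat} (k : a ⟶ b) :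
    (B.translate a.toGroup).obj ((B.translate (X.τ h)).obj q.toPath) =
      (B.translate (X.τ (X.α a.toGroup⁻¹ (k.1⁻¹ * h)))).obj
        ((B.translate b.toGroup).obj q.toPath) := by
  obtain ⟨k, hk⟩ := k
  change _ = (B.translate (X.τ (X.α a.toGroup⁻¹ (k⁻¹ * h)))).obj _
  rw [translate_obj_mul, translate_obj_mul, X.τ_α, ← hk, map_mul, map_inv]
  congr 2
  group

/-- The action of the categorical group of `(G, H, α, τ)`: `(p, g) ↦ p g` on objects and
`((γ, h), (h₁, g₁)) ↦ (γ g₁, α(g₁⁻¹)(h₁⁻¹ h))` on morphisms. -/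
def decAct : (DecCat A X × X.Cat) ⥤q DecCat A X where
  obj x := (B.translate x.2.toGroup).obj x.1.toPath
  map {x y} f :=
    { h := X.α x.2.toGroup⁻¹ (f.2.1⁻¹ * f.1.h)
      path := (B.translate x.2.toGroup).map f.1.path ≫
        eqToHom (decAct_target A X y.1 f.1.h f.2)
      horizontal := (f.1.horizontal.translate A _).eqToHom A _ }

end Bundle

end CatBundle

end

/-! A connection on `P → M` gives every piecewise `C¹` curve in `M` exactly one horizontal lift from
each point over its start. Existence: along `s ∘ c`, with `s` a local section, the lift `(s ∘ c) g`
is horizontal when `g' = dR_g ξ` for a curve `ξ` in the Lie algebra determined by `A`; this is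
solvable near each time, and local lifts are matched by translating them. Uniqueness: two lifts of
one curve differ by a curve in `G` whose velocity vanishes. Since the lift of `d⁻¹` is the reverse
of the lift of `d`, a lift of `a d d⁻¹ b` collapses to a lift of `a b`, so unique lifting descends
to backtrack-erased paths. The action of `G` permutes the lifts of a path freely and transitively,
and the decorations contribute only identities in the crossed module. -/

noncomputable section

namespace CatBundle

open Set Filter Topology

theorem interval_induction {Q : ℝ → ℝ → Prop} {a b : ℝ} (hab : a ≤ b)
    (htrans : ∀ u v w, u ≤ v → v ≤ w → Q u v → Q v w → Q u w)
    (hloc : ∀ t ∈ Icc a b, ∃ U ∈ 𝓝 t, ∀ u v, u ≤ v → Icc u v ⊆ U ∩ Icc a b → Q u v) :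
    Q a b := by
  choose! U hU hQU using hloc
  have hcover : univ ⊆ ⋃ t : Icc a b, ((↑) ⁻¹' interior (U t) : Set (Icc a b)) := fun t _ =>
    mem_iUnion.2 ⟨t, mem_interior_iff_mem_nhds.2 (hU t t.2)⟩
  obtain ⟨τ, hτ₀, hmono, ⟨n, hn⟩, hsub⟩ := exists_monotone_Icc_subset_open_cover_Icc hab
    (fun _ => isOpen_interior.preimage continuous_subtype_val) hcover
  have hstep (k : ℕ) : Q (τ k) (τ (k + 1)) := by
    obtain ⟨t, ht⟩ := hsub k
    refine hQU t t.2 _ _ (hmono k.le_succ) fun s hs => ?_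
    have hsab : s ∈ Icc a b := Icc_subset_Icc (τ k).2.1 (τ (k + 1)).2.2 hs
    exact ⟨interior_subset (ht (show ⟨s, hsab⟩ ∈ Icc (τ k) (τ (k + 1)) from hs)), hsab⟩
  have hQ (k : ℕ) : Q a (τ (k + 1)) := by
    induction k with
    | zero => simpa only [hτ₀] using hstep 0
    | succ k ih => exact htrans _ _ _ (τ (k + 1)).2.1 (hmono (k + 1).le_succ) ih (hstep (k + 1))
  simpa only [hn (n + 1) n.le_succ] using hQ n

section LinearODE

open scoped NNReal

variable {E V : Type*} [NormedAddCommGroup E] [NormedSpace ℝ E]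
  [NormedAddCommGroup V] [NormedSpace ℝ V]

theorem contDiffAt_one_of_hasDerivAt {α v : ℝ → E} {t₀ : ℝ}
    (hα : ∀ᶠ t in 𝓝 t₀, HasDerivAt α (v t) t) (hv : ∀ᶠ t in 𝓝 t₀, ContinuousAt v t) :
    ContDiffAt ℝ 1 α t₀ :=
  contDiffAt_one_iff.2 ⟨fun t => .toSpanSingleton ℝ (v t), _, hα.and hv,
    fun _ ht => ((ContinuousLinearMap.toSpanSingletonCLE (𝕜 := ℝ)).continuous.continuousAt.comp
      ht.2).continuousWithinAt, fun _ ht => ht.1.hasFDerivAt⟩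

theorem isPicardLindelof_clm_apply {F : E → V →L[ℝ] E} {ξ : ℝ → V} {x₀ : E} {t₀ : ℝ}
    {K a C D ε : ℝ≥0} (hF : LipschitzOnWith K F (Metric.closedBall x₀ a))
    (hD : ∀ x ∈ Metric.closedBall x₀ a, ‖F x‖ ≤ D)
    (hξ : ContinuousOn ξ (Metric.closedBall t₀ ε)) (hC : ∀ t ∈ Metric.closedBall t₀ ε, ‖ξ t‖ ≤ C)
    (hε : D * C * ε ≤ a) :
    IsPicardLindelof (fun t x => F x (ξ t)) (tmin := t₀ - ε) (tmax := t₀ + ε)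
      ⟨t₀, by simp, by simp⟩ x₀ a 0 (D * C) (K * C) := by
  rw [Real.closedBall_eq_Icc] at hξ hC
  refine ⟨fun t ht => LipschitzOnWith.of_dist_le_mul fun x hx y hy => ?_, fun x _ => ?_,
    fun t ht x hx => ?_, ?_⟩
  · calc dist (F x (ξ t)) (F y (ξ t)) = ‖(F x - F y) (ξ t)‖ := by rw [dist_eq_norm, sub_apply]
      _ ≤ ‖F x - F y‖ * ‖ξ t‖ := ContinuousLinearMap.le_opNorm _ _
      _ ≤ (K * dist x y) * C := by
        gcongr
        · exact dist_eq_norm (F x) (F y) ▸ hF.dist_le_mul x hx y hy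
        · exact hC t ht
      _ = (K * C : ℝ≥0) * dist x y := by push_cast; ring
  · exact (F x).continuous.comp_continuousOn hξ
  · exact (F x).le_of_opNorm_le_of_le (hD x hx) (hC t ht)
  · simpa using (by exact_mod_cast hε : (D * C * ε : ℝ) ≤ a)

theorem exists_eventually_hasDerivAt_clm_apply [CompleteSpace E] {F : E → V →L[ℝ] E} {x₀ : E}
    (hF : ContDiffAt ℝ 1 F x₀) {ξ : ℝ → V} (hξ : Continuous ξ) (t₀ : ℝ) :
    ∃ α : ℝ → E, α t₀ = x₀ ∧
      ∀ᶠ t in 𝓝 t₀, ContDiffAt ℝ 1 α t ∧ HasDerivAt α (F (α t) (ξ t)) t := by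
  obtain ⟨K, s, hs, hK⟩ := hF.exists_lipschitzOnWith
  have hFD : ∀ᶠ x in 𝓝 x₀, ‖F x‖ < ‖F x₀‖₊ + 1 :=
    hF.continuousAt.norm.eventually_lt_const (lt_add_one _)
  have hξC : ∀ᶠ t in 𝓝 t₀, ‖ξ t‖ < ‖ξ t₀‖₊ + 1 :=
    hξ.continuousAt.norm.eventually_lt_const (lt_add_one _)
  obtain ⟨a, ha, hball⟩ := Metric.nhds_basis_closedBall.mem_iff.1 (inter_mem hs hFD)
  obtain ⟨δ, hδ, hξδ⟩ := Metric.nhds_basis_closedBall.mem_iff.1 hξC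
  lift a to ℝ≥0 using ha.le
  lift δ to ℝ≥0 using hδ.le
  set C := ‖ξ t₀‖₊ + 1
  set D := ‖F x₀‖₊ + 1
  have hDC : 0 < D * C := by positivity
  set ε := min δ (a / (D * C))
  have hε : 0 < ε := lt_min (by exact_mod_cast hδ) (div_pos (by exact_mod_cast ha) hDC)
  have hPL := isPicardLindelof_clm_apply (ξ := ξ) (t₀ := t₀) (C := C) (D := D) (ε := ε)
    (hK.mono fun x hx => (hball hx).1) (fun x hx => (hball hx).2.le) hξ.continuousOn
    (fun t ht => (hξδ (Metric.closedBall_subset_closedBall (min_le_left _ _) ht)).le)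
    ((mul_le_mul_right (min_le_right _ _) _).trans_eq (mul_div_cancel₀ _ hDC.ne'))
  obtain ⟨α, hα₀ : α t₀ = x₀, hα⟩ := hPL.exists_eq_forall_mem_Icc_hasDerivWithinAt₀
  have hderiv : ∀ᶠ t in 𝓝 t₀, HasDerivAt α (F (α t) (ξ t)) t := by
    filter_upwards [Ioo_mem_nhds (sub_lt_self t₀ (NNReal.coe_pos.2 hε))
      (lt_add_of_pos_right t₀ (NNReal.coe_pos.2 hε))] with t ht
    exact (hα t (Ioo_subset_Icc_self ht)).hasDerivAt (Icc_mem_nhds ht.1 ht.2)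
  have hFα : ∀ᶠ t in 𝓝 t₀, ContDiffAt ℝ 1 F (α t) :=
    hderiv.self_of_nhds.continuousAt.eventually (hα₀ ▸ hF.eventually (by simp))
  have hcont : ∀ᶠ t in 𝓝 t₀, ContinuousAt (fun t => F (α t) (ξ t)) t := by
    filter_upwards [hderiv, hFα] with t ht hFt
    exact (ContinuousAt.comp hFt.continuousAt ht.continuousAt).clm_apply hξ.continuousAt
  exact ⟨α, hα₀, ((contDiffAt_one_of_hasDerivAt hderiv hcont).eventually (by simp)).and hderiv⟩

end LinearODE

section Velocity

variable {E X E' Y : Type*} [NormedAddCommGroup E] [NormedSpace ℝ E]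
  [TopologicalSpace X] [ChartedSpace E X] [NormedAddCommGroup E'] [NormedSpace ℝ E']
  [TopologicalSpace Y] [ChartedSpace E' Y]

/-- The differential of a map between manifolds, with all tangent spaces identified with the model
spaces, so that differentials at different points can be composed and compared. -/
def tderiv (E E' : Type*) {X Y : Type*} [NormedAddCommGroup E] [NormedSpace ℝ E]
    [TopologicalSpace X] [ChartedSpace E X] [NormedAddCommGroup E'] [NormedSpace ℝ E']
    [TopologicalSpace Y] [ChartedSpace E' Y] (F : X → Y) (x : X) : E →L[ℝ] E' :=
  mfderiv 𝓘(ℝ, E) 𝓘(ℝ, E') F x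

/-- The velocity of a curve in a manifold, as an element of the model space. -/
def velocity (E : Type*) {X : Type*} [NormedAddCommGroup E] [NormedSpace ℝ E]
    [TopologicalSpace X] [ChartedSpace E X] (γ : ℝ → X) (t : ℝ) : E :=
  tderiv ℝ E γ t 1

theorem tderiv_comp {E'' Z : Type*} [NormedAddCommGroup E''] [NormedSpace ℝ E'']
    [TopologicalSpace Z] [ChartedSpace E'' Z] {F : Y → Z} {f : X → Y} {x : X}
    (hF : MDifferentiableAt 𝓘(ℝ, E') 𝓘(ℝ, E'') F (f x))
    (hf : MDifferentiableAt 𝓘(ℝ, E) 𝓘(ℝ, E') f x) :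
    tderiv E E'' (fun x => F (f x)) x = (tderiv E' E'' F (f x)).comp (tderiv E E' f x) :=
  mfderiv_comp x hF hf

theorem tderiv_congr {F F' : X → Y} {x : X} (h : F =ᶠ[𝓝 x] F') :
    tderiv E E' F x = tderiv E E' F' x := h.mfderiv_eq

theorem tderiv_id {x : X} : tderiv E E (fun x : X => x) x = ContinuousLinearMap.id ℝ E :=
  mfderiv_id

theorem tderiv_eq_fderiv {F : E → E'} {x : E} : tderiv E E' F x = fderiv ℝ F x :=
  mfderiv_eq_fderiv

theorem velocity_comp {F : X → Y} {γ : ℝ → X} {t : ℝ}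
    (hF : MDifferentiableAt 𝓘(ℝ, E) 𝓘(ℝ, E') F (γ t))
    (hγ : MDifferentiableAt 𝓘(ℝ, ℝ) 𝓘(ℝ, E) γ t) :
    velocity E' (fun t => F (γ t)) t = tderiv E E' F (γ t) (velocity E γ t) :=
  congrArg (fun L : ℝ →L[ℝ] E' => L 1) (tderiv_comp hF hγ)

theorem velocity_congr {γ γ' : ℝ → X} {t : ℝ} (h : γ =ᶠ[𝓝 t] γ') :
    velocity E γ t = velocity E γ' t :=
  congrArg (fun L : ℝ →L[ℝ] E => L 1) (tderiv_congr h)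

theorem velocity_eq_deriv {x : ℝ → E} {t : ℝ} : velocity E x t = deriv x t :=
  congrArg (fun L : ℝ →L[ℝ] E => L 1) tderiv_eq_fderiv

end Velocity

section Chart

variable {E X : Type*} [NormedAddCommGroup E] [NormedSpace ℝ E]
  [TopologicalSpace X] [ChartedSpace E X] [IsManifold 𝓘(ℝ, E) ∞ X]

theorem contMDiffAt_extChartAt_symm {x : X} {y : E} (hy : y ∈ (extChartAt 𝓘(ℝ, E) x).target) :
    ContMDiffAt 𝓘(ℝ, E) 𝓘(ℝ, E) ∞ (extChartAt 𝓘(ℝ, E) x).symm y :=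
  (contMDiffOn_extChartAt_symm x).contMDiffAt ((isOpen_extChartAt_target x).mem_nhds hy)

theorem contMDiffAt_extChartAt_of_mem_source {x y : X} (hy : y ∈ (extChartAt 𝓘(ℝ, E) x).source) :
    ContMDiffAt 𝓘(ℝ, E) 𝓘(ℝ, E) ∞ (extChartAt 𝓘(ℝ, E) x) y :=
  contMDiffAt_extChartAt' (by rwa [← extChartAt_source 𝓘(ℝ, E)])

theorem tderiv_extChartAt_symm_tderiv_extChartAt {x y : X}
    (hy : y ∈ (extChartAt 𝓘(ℝ, E) x).source) (v : E) :
    tderiv E E (extChartAt 𝓘(ℝ, E) x).symm (extChartAt 𝓘(ℝ, E) x y)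
      (tderiv E E (extChartAt 𝓘(ℝ, E) x) y v) = v := by
  set e := extChartAt 𝓘(ℝ, E) x
  have hcomp := tderiv_comp
    ((contMDiffAt_extChartAt_symm (e.map_source hy)).mdifferentiableAt (by simp))
    ((contMDiffAt_extChartAt_of_mem_source hy).mdifferentiableAt (by simp))
  have hleft : (fun z => e.symm (e z)) =ᶠ[𝓝 y] fun z => z := by
    filter_upwards [(isOpen_extChartAt_source x).mem_nhds hy] with z hz using e.left_inv hz
  rw [tderiv_congr hleft, tderiv_id] at hcomp
  exact (congrArg (fun L : E →L[ℝ] E => L v) hcomp).symm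

end Chart

section LieGroup

variable {EG G : Type*} [NormedAddCommGroup EG] [NormedSpace ℝ EG]
  [TopologicalSpace G] [ChartedSpace EG G] [Group G]

/-- Right multiplication by the group element with coordinates `x`, in the coordinates given by the
chart at `1`. -/
def mulRightInChart (EG G : Type*) [NormedAddCommGroup EG] [NormedSpace ℝ EG]
    [TopologicalSpace G] [ChartedSpace EG G] [Group G] (x y : EG) : EG :=
  extChartAt 𝓘(ℝ, EG) (1 : G)
    ((extChartAt 𝓘(ℝ, EG) (1 : G)).symm y * (extChartAt 𝓘(ℝ, EG) (1 : G)).symm x)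

theorem mulRightInChart_extChartAt_one {x : EG} (hx : x ∈ (extChartAt 𝓘(ℝ, EG) (1 : G)).target) :
    mulRightInChart EG G x (extChartAt 𝓘(ℝ, EG) (1 : G) 1) = x := by
  rw [mulRightInChart, extChartAt_to_inv, one_mul, (extChartAt 𝓘(ℝ, EG) (1 : G)).right_inv hx]

variable [LieGroup 𝓘(ℝ, EG) ∞ G]

theorem mdifferentiable_mul_right (g : G) :
    MDifferentiable 𝓘(ℝ, EG) 𝓘(ℝ, EG) (fun y : G => y * g) :=
  (contMDiff_mul_right (I := 𝓘(ℝ, EG)) (n := ∞) (a := g)).mdifferentiable (by simp)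

theorem mdifferentiable_mul_left (g : G) :
    MDifferentiable 𝓘(ℝ, EG) 𝓘(ℝ, EG) (fun y : G => g * y) :=
  (contMDiff_mul_left (I := 𝓘(ℝ, EG)) (n := ∞) (a := g)).mdifferentiable (by simp)

theorem contDiffAt_mulRightInChart {x : EG} (hx : x ∈ (extChartAt 𝓘(ℝ, EG) (1 : G)).target) :
    ContDiffAt ℝ ∞ (Function.uncurry (mulRightInChart EG G))
      (x, extChartAt 𝓘(ℝ, EG) (1 : G) 1) := by
  have : IsManifold 𝓘(ℝ, EG) ∞ G := LieGroup.toContMDiffMul.toIsManifold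
  rw [← contMDiffAt_iff_contDiffAt]
  set e := extChartAt 𝓘(ℝ, EG) (1 : G)
  have hmul : ContMDiffAt 𝓘(ℝ, EG × EG) 𝓘(ℝ, EG) ∞
      (fun z : EG × EG => e.symm z.2 * e.symm z.1) (x, e 1) :=
    ((contMDiffAt_extChartAt_symm (mem_extChartAt_target (1 : G))).comp (x, e 1)
      contDiffAt_snd.contMDiffAt).mul
      ((contMDiffAt_extChartAt_symm hx).comp (x, e 1) contDiffAt_fst.contMDiffAt)
  refine ContMDiffAt.comp (x, e 1) (contMDiffAt_extChartAt_of_mem_source ?_) hmul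
  rw [extChartAt_to_inv, one_mul]
  exact e.map_target hx

theorem tderiv_extChartAt_symm_fderiv_mulRightInChart {x : EG}
    (hx : x ∈ (extChartAt 𝓘(ℝ, EG) (1 : G)).target) (v : EG) :
    tderiv EG EG (extChartAt 𝓘(ℝ, EG) (1 : G)).symm x
        (fderiv ℝ (mulRightInChart EG G x) (extChartAt 𝓘(ℝ, EG) (1 : G) 1) v) =
      tderiv EG EG (fun y : G => y * (extChartAt 𝓘(ℝ, EG) (1 : G)).symm x) 1
        (tderiv EG EG (extChartAt 𝓘(ℝ, EG) (1 : G)).symm (extChartAt 𝓘(ℝ, EG) (1 : G) 1) v) := by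
  have : IsManifold 𝓘(ℝ, EG) ∞ G := LieGroup.toContMDiffMul.toIsManifold
  set e := extChartAt 𝓘(ℝ, EG) (1 : G)
  have he1 : e.symm (e 1) = 1 := extChartAt_to_inv 1
  have hes {y : EG} (hy : y ∈ e.target) : MDifferentiableAt 𝓘(ℝ, EG) 𝓘(ℝ, EG) e.symm y :=
    (contMDiffAt_extChartAt_symm hy).mdifferentiableAt (by simp)
  have hμ : MDifferentiableAt 𝓘(ℝ, EG) 𝓘(ℝ, EG) (mulRightInChart EG G x) (e 1) :=
    ((contDiffAt_mulRightInChart hx).comp (e 1)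
      (contDiffAt_const.prodMk contDiffAt_id)).contMDiffAt.mdifferentiableAt (by simp)
  have hμ1 : mulRightInChart EG G x (e 1) = x := mulRightInChart_extChartAt_one hx
  have hmul : MDifferentiableAt 𝓘(ℝ, EG) 𝓘(ℝ, EG) (fun y => e.symm y * e.symm x) (e 1) :=
    (mdifferentiable_mul_right (e.symm x) _).comp (e 1) (hes (mem_extChartAt_target (1 : G)))
  have hsource : ∀ᶠ y in 𝓝 (e 1), e.symm y * e.symm x ∈ e.source :=
    hmul.continuousAt.eventually_mem ((isOpen_extChartAt_source (1 : G)).mem_nhds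
      (by rw [he1, one_mul]; exact e.map_target hx))
  have hleft : (fun y => e.symm (mulRightInChart EG G x y)) =ᶠ[𝓝 (e 1)]
      fun y => e.symm y * e.symm x := by
    filter_upwards [hsource] with y hy using e.left_inv hy
  have hcomp := tderiv_congr (E := EG) (E' := EG) hleft
  rw [tderiv_comp (by rw [hμ1]; exact hes hx) hμ, tderiv_comp (mdifferentiable_mul_right _ _)
    (hes (mem_extChartAt_target (1 : G))), hμ1, he1, tderiv_eq_fderiv] at hcomp
  exact congrArg (fun L : EG →L[ℝ] EG => L v) hcomp

theorem contDiffAt_fderiv_mulRightInChart :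
    ContDiffAt ℝ ∞ (fun x => fderiv ℝ (mulRightInChart EG G x) (extChartAt 𝓘(ℝ, EG) (1 : G) 1))
      (extChartAt 𝓘(ℝ, EG) (1 : G) 1) :=
  (contDiffAt_mulRightInChart (mem_extChartAt_target 1)).fderiv contDiffAt_const le_rfl

theorem exists_velocity_eq_tderiv_mul_right [CompleteSpace EG] {ξ : ℝ → EG} (hξ : Continuous ξ)
    (t₀ : ℝ) :
    ∃ g : ℝ → G, g t₀ = 1 ∧ ∀ᶠ t in 𝓝 t₀, ContMDiffAt 𝓘(ℝ, ℝ) 𝓘(ℝ, EG) 1 g t ∧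
      velocity EG g t = tderiv EG EG (fun y : G => y * g t) 1 (ξ t) := by
  have : IsManifold 𝓘(ℝ, EG) ∞ G := LieGroup.toContMDiffMul.toIsManifold
  set e := extChartAt 𝓘(ℝ, EG) (1 : G)
  have h1 : (1 : G) ∈ e.source := mem_extChartAt_source 1
  obtain ⟨α, hα₀, hα⟩ := exists_eventually_hasDerivAt_clm_apply
    ((contDiffAt_fderiv_mulRightInChart (EG := EG) (G := G)).of_le (by simp))
    ((tderiv EG EG e 1).continuous.comp hξ) t₀
  have htarget : ∀ᶠ t in 𝓝 t₀, α t ∈ e.target :=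
    hα.self_of_nhds.1.continuousAt.eventually_mem
      (hα₀ ▸ (isOpen_extChartAt_target (1 : G)).mem_nhds (e.map_source h1))
  refine ⟨fun t => e.symm (α t), (congrArg e.symm hα₀).trans (e.left_inv h1), ?_⟩
  filter_upwards [hα, htarget] with t ⟨hαt, hderiv⟩ ht
  have hes := contMDiffAt_extChartAt_symm ht
  refine ⟨(hes.of_le (by simp)).comp t hαt.contMDiffAt, ?_⟩
  rw [velocity_comp (hes.mdifferentiableAt (by simp)) hderiv.differentiableAt.mdifferentiableAt,
    velocity_eq_deriv, hderiv.deriv, tderiv_extChartAt_symm_fderiv_mulRightInChart ht]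
  exact congrArg _ (tderiv_extChartAt_symm_tderiv_extChartAt h1 (ξ t))

end LieGroup

theorem eqOn_piecewise_Iic {X : Type*} {f g : ℝ → X} {v : ℝ} (h : f v = g v) :
    EqOn ((Iic v).piecewise f g) g (Ici v) := fun t ht => by
  rcases (mem_Ici.1 ht).eq_or_lt with rfl | hlt
  · rw [piecewise_eq_of_mem _ _ _ self_mem_Iic, h]
  · exact piecewise_eq_of_notMem _ _ _ (notMem_Iic.2 hlt)

section Piecewise

variable {E X : Type*} [NormedAddCommGroup E] [NormedSpace ℝ E]
  [TopologicalSpace X] [ChartedSpace E X]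

theorem PiecewiseC1.mono {f : ℝ → X} {a b a' b' : ℝ} (hf : PiecewiseC1 E f a b) (ha : a ≤ a')
    (hb : b' ≤ b) : PiecewiseC1 E f a' b' :=
  hf.imp fun _ hS u v hu hv hs => hS u v (ha.trans hu) (hv.trans hb) hs

theorem PiecewiseC1.of_contMDiffOn {f : ℝ → X} {a b : ℝ}
    (hf : ContMDiffOn 𝓘(ℝ, ℝ) 𝓘(ℝ, E) 1 f (Icc a b)) : PiecewiseC1 E f a b :=
  ⟨∅, fun _ _ hu hv _ => hf.mono (Icc_subset_Icc hu hv)⟩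

theorem PiecewiseC1.piecewise {f g : ℝ → X} {a v b : ℝ} (hf : PiecewiseC1 E f a v)
    (hg : PiecewiseC1 E g v b) (h : f v = g v) : PiecewiseC1 E ((Iic v).piecewise f g) a b := by
  classical
  obtain ⟨S, hS⟩ := hf
  obtain ⟨S', hS'⟩ := hg
  refine ⟨S ∪ S' ∪ {v}, fun u w hu hw hs => ?_⟩
  have hv : v ∉ Ioo u w := hs v (by simp)
  rcases le_or_gt w v with hwv | hwv
  · exact (hS u w hu hwv fun s hsS => hs s (by simp [hsS])).congr fun t ht =>
      piecewise_eq_of_mem _ _ _ (ht.2.trans hwv)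
  · have hvu : v ≤ u := not_lt.1 fun hlt => hv ⟨hlt, hwv⟩
    exact (hS' u w hvu hw fun s hsS => hs s (by simp [hsS])).congr fun t ht =>
      eqOn_piecewise_Iic h (hvu.trans ht.1)

theorem PiecewiseC1.induction {f : ℝ → X} {a b : ℝ} (hf : PiecewiseC1 E f a b) (hab : a ≤ b)
    {Q : ℝ → ℝ → Prop} (htrans : ∀ u v w, u ≤ v → v ≤ w → Q u v → Q v w → Q u w)
    (hQ : ∀ u v, u ≤ v → Icc u v ⊆ Icc a b → ContMDiffOn 𝓘(ℝ, ℝ) 𝓘(ℝ, E) 1 f (Icc u v) → Q u v) :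
    Q a b := by
  classical
  obtain ⟨S, hS⟩ := hf
  refine interval_induction hab htrans fun t _ => ⟨(↑(S.erase t))ᶜ,
    (S.erase t).finite_toSet.isClosed.isOpen_compl.mem_nhds (by simp), fun u v huv hsub => ?_⟩
  have hpiece (u' v' : ℝ) (hu : u ≤ u') (huv' : u' ≤ v') (hv : v' ≤ v) (ht : t ∉ Ioo u' v') :
      Q u' v' := by
    have hab' : Icc u' v' ⊆ Icc a b := (Icc_subset_Icc hu hv).trans fun s hs => (hsub hs).2
    refine hQ u' v' huv' hab' (hS u' v' (hab' (left_mem_Icc.2 huv')).1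
      (hab' (right_mem_Icc.2 huv')).2 fun s hs hsu => ?_)
    refine (hsub ⟨hu.trans hsu.1.le, hsu.2.le.trans hv⟩).1 (Finset.mem_erase.2 ⟨?_, hs⟩)
    rintro rfl
    exact ht hsu
  by_cases ht : t ∈ Ioo u v
  · exact htrans u t v ht.1.le ht.2.le (hpiece u t le_rfl ht.1.le ht.2.le (by simp))
      (hpiece t v ht.1.le ht.2.le le_rfl (by simp))
  · exact hpiece u v le_rfl huv le_rfl ht

theorem PiecewiseC1.continuousOn {f : ℝ → X} {a b : ℝ} (hf : PiecewiseC1 E f a b) :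
    ContinuousOn f (Icc a b) := by
  rcases le_or_gt a b with hab | hab
  · refine hf.induction hab (Q := fun u v => ContinuousOn f (Icc u v))
      (fun u v w huv hvw h h' => ?_) fun u v _ _ h => h.continuousOn
    rw [← Icc_union_Icc_eq_Icc huv hvw]
    exact h.union_of_isClosed h' isClosed_Icc isClosed_Icc
  · simp [Icc_eq_empty_of_lt hab]

theorem PiecewiseC1.eventually_cofinite_mdifferentiableAt {f : ℝ → X} {a b : ℝ}
    (hf : PiecewiseC1 E f a b) :
    ∀ᶠ t in cofinite, t ∈ Ioo a b → MDifferentiableAt 𝓘(ℝ, ℝ) 𝓘(ℝ, E) f t := by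
  obtain ⟨S, hS⟩ := hf
  filter_upwards [S.eventually_cofinite_notMem] with t hts ht
  obtain ⟨u, v, htuv, hnhds, hsub⟩ := exists_Icc_mem_subset_of_mem_nhds
    (inter_mem (S.finite_toSet.isClosed.isOpen_compl.mem_nhds (by simpa using hts))
      (Ioo_mem_nhds ht.1 ht.2))
  have huv := htuv.1.trans htuv.2
  exact ((hS u v (hsub (left_mem_Icc.2 huv)).2.1.le (hsub (right_mem_Icc.2 huv)).2.2.le
    fun s hs hsu => (hsub (Ioo_subset_Icc_self hsu)).1 hs).contMDiffAt hnhds).mdifferentiableAt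
      one_ne_zero

end Piecewise

section Bundle

variable {EG EP EM G P M : Type*}
  [NormedAddCommGroup EG] [NormedSpace ℝ EG] [NormedAddCommGroup EP] [NormedSpace ℝ EP]
  [NormedAddCommGroup EM] [NormedSpace ℝ EM]
  [TopologicalSpace G] [ChartedSpace EG G] [Group G]
  [TopologicalSpace P] [ChartedSpace EP P] [TopologicalSpace M] [ChartedSpace EM M]
  (B : PrincipalBundle EG EP EM G P M)

namespace PrincipalBundle

theorem mdifferentiable_translate (g : G) :
    MDifferentiable 𝓘(ℝ, EP) 𝓘(ℝ, EP) (fun p => B.act p g) :=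
  (B.contMDiff_translate g).mdifferentiable (by simp)

theorem mdifferentiable_orbit [IsManifold 𝓘(ℝ, EG) ∞ G] (p : P) :
    MDifferentiable 𝓘(ℝ, EG) 𝓘(ℝ, EP) (fun g => B.act p g) :=
  (B.contMDiff_act.comp (contMDiff_const.prodMk contMDiff_id)).mdifferentiable (by simp)

theorem velocity_act {γ : ℝ → P} {g : ℝ → G} {t : ℝ}
    (hγ : MDifferentiableAt 𝓘(ℝ, ℝ) 𝓘(ℝ, EP) γ t) (hg : MDifferentiableAt 𝓘(ℝ, ℝ) 𝓘(ℝ, EG) g t) :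
    velocity EP (fun t => B.act (γ t) (g t)) t =
      tderiv EP EP (fun p => B.act p (g t)) (γ t) (velocity EP γ t) +
        tderiv EG EP (fun k => B.act (γ t) k) (g t) (velocity EG g t) := by
  have hact : MDifferentiableAt (𝓘(ℝ, EP).prod 𝓘(ℝ, EG)) 𝓘(ℝ, EP)
      (fun x : P × G => B.act x.1 x.2) (γ t, g t) := B.contMDiff_act.mdifferentiable (by simp) _
  have hchain := mfderiv_comp t hact (hγ.prodMk hg)
  rw [hγ.mfderiv_prod hg] at hchain
  exact (congrArg (fun L : ℝ →L[ℝ] EP => L 1) hchain).trans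
    (mfderiv_prod_eq_add_apply (v := (velocity EP γ t, velocity EG g t)) hact)

theorem act_right_injective (p : P) : Function.Injective (B.act p) := fun g k h => by
  have hg : B.act p (g * k⁻¹) = p := by rw [← B.act_mul, h, B.act_mul, mul_inv_cancel, B.act_one]
  exact mul_inv_eq_one.1 (B.act_free p _ hg)

theorem act_left_injective (g : G) : Function.Injective fun p => B.act p g := fun p q h => by
  have htranslate : B.act (B.act p g) g⁻¹ = B.act (B.act q g) g⁻¹ := congrArg (B.act · g⁻¹) h
  simpa only [B.act_mul, mul_inv_cancel, B.act_one] using htranslate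

theorem exists_local_section (x : M) :
    ∃ U ∈ 𝓝 x, ∃ (σ : M → P) (κ : P → G), ContMDiffOn 𝓘(ℝ, EM) 𝓘(ℝ, EP) ∞ σ U ∧
      (∀ p, B.proj p ∈ U → ContMDiffAt 𝓘(ℝ, EP) 𝓘(ℝ, EG) ∞ κ p) ∧
      (∀ u ∈ U, B.proj (σ u) = u) ∧ ∀ p, B.proj p ∈ U → B.act (σ (B.proj p)) (κ p) = p := by
  obtain ⟨U, φ, hU, hxU, hsource, htarget, hφ, hφsymm, hact⟩ := B.locally_trivial x
  refine ⟨U, hU.mem_nhds hxU, fun u => φ (u, 1), fun p => (φ.symm p).2,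
    hφ.comp (contMDiffOn_id.prodMk contMDiffOn_const) fun u hu => ?_,
    fun p hp => contMDiffAt_snd.comp p (hφsymm.contMDiffAt
      (htarget ▸ (hU.preimage B.contMDiff_proj.continuous).mem_nhds hp)),
    fun u hu => (hact u hu 1 1).1, fun p hp => ?_⟩
  · exact hsource ▸ mk_mem_prod hu (mem_univ 1)
  · obtain ⟨⟨u, k⟩, hsrc, rfl⟩ : p ∈ φ '' φ.source := by rwa [φ.image_source_eq_target, htarget]
    have hu : u ∈ U := (hsource ▸ hsrc : (u, k) ∈ U ×ˢ univ).1
    simp only [φ.left_inv hsrc, (hact u hu k 1).1, (hact u hu 1 k).2, one_mul]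

theorem exists_act_eq {p q : P} (h : B.proj p = B.proj q) : ∃ g, B.act p g = q := by
  obtain ⟨U, hU, σ, κ, -, -, -, hκ⟩ := B.exists_local_section (B.proj p)
  have hp := hκ p (mem_of_mem_nhds hU)
  have hq := hκ q (h ▸ mem_of_mem_nhds hU)
  exact ⟨(κ p)⁻¹ * κ q, calc
    B.act p ((κ p)⁻¹ * κ q) = B.act (B.act (σ (B.proj p)) (κ p)) ((κ p)⁻¹ * κ q) := by rw [hp]
    _ = B.act (σ (B.proj q)) (κ q) := by rw [B.act_mul, mul_inv_cancel_left, h]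
    _ = q := hq⟩

/-- The translation function of a principal bundle: the element of the structure group that carries
`p` to `q`. It has a meaning only if `p` and `q` lie in the same fiber. -/
def div (p q : P) : G := Classical.epsilon fun g => B.act p g = q

theorem act_div {p q : P} (h : B.proj p = B.proj q) : B.act p (B.div p q) = q :=
  Classical.epsilon_spec (B.exists_act_eq h)

theorem div_self (p : P) : B.div p p = 1 := B.act_free p _ (B.act_div rfl)

theorem exists_contMDiffAt_eq_div [LieGroup 𝓘(ℝ, EG) ∞ G] {p q : P} (h : B.proj p = B.proj q) :
    ∃ D : P × P → G, ContMDiffAt (𝓘(ℝ, EP).prod 𝓘(ℝ, EP)) 𝓘(ℝ, EG) ∞ D (p, q) ∧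
      ∀ᶠ x in 𝓝 (p, q), B.proj x.1 = B.proj x.2 → B.div x.1 x.2 = D x := by
  obtain ⟨U, hU, σ, κ, -, hκ, -, hact⟩ := B.exists_local_section (B.proj p)
  refine ⟨fun x => (κ x.1)⁻¹ * κ x.2, ?_, ?_⟩
  · have hp := (hκ p (mem_of_mem_nhds hU)).comp (p, q) (contMDiffAt_fst (J := 𝓘(ℝ, EP)))
    have hq := (hκ q (h ▸ mem_of_mem_nhds hU)).comp (p, q) (contMDiffAt_snd (I := 𝓘(ℝ, EP)))
    exact hp.inv.mul hq
  · filter_upwards [(B.contMDiff_proj.continuous.comp continuous_fst).continuousAt hU] with x hx hpq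
    have hdiv : κ x.1 * B.div x.1 x.2 = κ x.2 := B.act_right_injective (σ (B.proj x.1)) <| by
      rw [← B.act_mul, hact x.1 hx, B.act_div hpq, hpq, hact x.2 (hpq ▸ hx)]
    exact eq_inv_mul_of_mul_eq hdiv

theorem continuousOn_div [LieGroup 𝓘(ℝ, EG) ∞ G] {Y : Type*} [TopologicalSpace Y] {s : Set Y}
    {γ γ' : Y → P} (hγ : ContinuousOn γ s) (hγ' : ContinuousOn γ' s)
    (h : ∀ y ∈ s, B.proj (γ y) = B.proj (γ' y)) :
    ContinuousOn (fun y => B.div (γ y) (γ' y)) s := fun y hy => by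
  obtain ⟨D, hD, hdiv⟩ := B.exists_contMDiffAt_eq_div (h y hy)
  have hpair := (hγ y hy).prodMk (hγ' y hy)
  refine (ContinuousAt.comp_continuousWithinAt (f := fun y => (γ y, γ' y))
    hD.continuousAt hpair).congr_of_eventuallyEq_of_mem ?_ hy
  filter_upwards [hpair.eventually hdiv, self_mem_nhdsWithin] with z hz hzs using hz (h z hzs)

theorem mdifferentiableAt_div [LieGroup 𝓘(ℝ, EG) ∞ G] {γ γ' : ℝ → P} {t : ℝ}
    (hγ : MDifferentiableAt 𝓘(ℝ, ℝ) 𝓘(ℝ, EP) γ t) (hγ' : MDifferentiableAt 𝓘(ℝ, ℝ) 𝓘(ℝ, EP) γ' t)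
    (h : ∀ᶠ s in 𝓝 t, B.proj (γ s) = B.proj (γ' s)) :
    MDifferentiableAt 𝓘(ℝ, ℝ) 𝓘(ℝ, EG) (fun s => B.div (γ s) (γ' s)) t := by
  obtain ⟨D, hD, hdiv⟩ := B.exists_contMDiffAt_eq_div h.self_of_nhds
  have hpair := hγ.prodMk hγ'
  refine ((hD.mdifferentiableAt (by simp)).comp t hpair).congr_of_eventuallyEq ?_
  filter_upwards [hpair.continuousAt.eventually hdiv, h] with s hs hproj using hs hproj

end PrincipalBundle

variable [IsManifold 𝓘(ℝ, EP) ∞ P] {B} (A : Connection B)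

namespace Connection

/-- The connection form at a point, as a linear map between the model spaces. -/
def formAt (p : P) : EP →L[ℝ] EG := A.form p

theorem formAt_translate (p : P) (g : G) (v : EP) :
    A.formAt (B.act p g) (tderiv EP EP (fun q => B.act q g) p v) =
      tderiv EG EG (fun x : G => g⁻¹ * x * g⁻¹⁻¹) 1 (A.formAt p v) := A.equivariant p g v

theorem formAt_tderiv_orbit_one (p : P) (Y : EG) :
    A.formAt p (tderiv EG EP (fun g : G => B.act p g) 1 Y) = Y := by
  have hvertical : A.formAt (B.act p 1) (tderiv EG EP (fun g : G => B.act p g) 1 Y) = Y :=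
    A.vertical p Y
  rwa [B.act_one] at hvertical

variable [LieGroup 𝓘(ℝ, EG) ∞ G]

theorem formAt_tderiv_orbit_mul_left (p : P) (g : G) (Y : EG) :
    A.formAt (B.act p g) (tderiv EG EP (fun k => B.act p k) g
      (tderiv EG EG (fun y : G => g * y) 1 Y)) = Y := by
  have : IsManifold 𝓘(ℝ, EG) ∞ G := LieGroup.toContMDiffMul.toIsManifold
  have horbit := tderiv_comp (B.mdifferentiable_orbit p (g * 1)) (mdifferentiable_mul_left g 1)
  simp only [← B.act_mul, mul_one] at horbit
  have hone := A.formAt_tderiv_orbit_one (B.act p g) Y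
  rwa [horbit] at hone

theorem formAt_tderiv_orbit_mul_right (p : P) (g : G) (Y : EG) :
    A.formAt (B.act p g) (tderiv EG EP (fun k => B.act p k) g
      (tderiv EG EG (fun y : G => y * g) 1 Y)) =
      tderiv EG EG (fun x : G => g⁻¹ * x * g⁻¹⁻¹) 1 Y := by
  have : IsManifold 𝓘(ℝ, EG) ∞ G := LieGroup.toContMDiffMul.toIsManifold
  have horbit := tderiv_comp (f := fun y : G => y * g) (B.mdifferentiable_orbit p (1 * g))
    (mdifferentiable_mul_right g 1)
  have htranslate := tderiv_comp (B.mdifferentiable_translate g _) (B.mdifferentiable_orbit p 1)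
  simp only [B.act_mul, B.act_one, one_mul] at horbit htranslate
  have happly := congrArg (fun L : EG →L[ℝ] EP => A.formAt (B.act p g) (L Y))
    (horbit.symm.trans htranslate)
  exact happly.trans (by
    rw [ContinuousLinearMap.comp_apply, A.formAt_translate, A.formAt_tderiv_orbit_one])

theorem velocity_eq_zero_of_formAt_eq_zero {γ : ℝ → P} {g : ℝ → G} {t : ℝ}
    (hγ : MDifferentiableAt 𝓘(ℝ, ℝ) 𝓘(ℝ, EP) γ t) (hg : MDifferentiableAt 𝓘(ℝ, ℝ) 𝓘(ℝ, EG) g t)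
    (h : A.formAt (γ t) (velocity EP γ t) = 0)
    (h' : A.formAt (B.act (γ t) (g t)) (velocity EP (fun t => B.act (γ t) (g t)) t) = 0) :
    velocity EG g t = 0 := by
  obtain ⟨Y, hY⟩ : ∃ Y, tderiv EG EG (fun y : G => g t * y) 1 Y = velocity EG g t := by
    have hinv := tderiv_comp (E' := EG) (F := fun y : G => g t * y) (f := fun y : G => (g t)⁻¹ * y)
      (x := g t) (mdifferentiable_mul_left _ _) (mdifferentiable_mul_left _ _)
    simp only [mul_inv_cancel_left, tderiv_id, inv_mul_cancel] at hinv
    exact ⟨_, congrArg (fun L : EG →L[ℝ] EG => L (velocity EG g t)) hinv.symm⟩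
  rw [B.velocity_act hγ hg, map_add, A.formAt_translate, h, map_zero, zero_add, ← hY,
    A.formAt_tderiv_orbit_mul_left] at h'
  rw [← hY, h', map_zero]

end Connection

end Bundle

section HorizontalLift

variable {EG EP EM G P M : Type*}
  [NormedAddCommGroup EG] [NormedSpace ℝ EG] [NormedAddCommGroup EP] [NormedSpace ℝ EP]
  [NormedAddCommGroup EM] [NormedSpace ℝ EM]
  [TopologicalSpace G] [ChartedSpace EG G] [Group G]
  [TopologicalSpace P] [ChartedSpace EP P] [TopologicalSpace M] [ChartedSpace EM M]
  [IsManifold 𝓘(ℝ, EP) ∞ P] {B : PrincipalBundle EG EP EM G P M}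

namespace Connection

/-- The curve `γ` is horizontal on `(a, b)`, apart from finitely many times. -/
def IsHorizontalOn (A : Connection B) (γ : ℝ → P) (a b : ℝ) : Prop :=
  ∀ᶠ t in cofinite, t ∈ Ioo a b → A.formAt (γ t) (velocity EP γ t) = 0

/-- The curve `γ` on `P` is a horizontal lift of the curve `c` over `[a, b]`. -/
structure IsLift (A : Connection B) (c : ℝ → M) (γ : ℝ → P) (a b : ℝ) : Prop where
  piecewiseC1 : PiecewiseC1 EP γ a b
  horizontal : A.IsHorizontalOn γ a b
  proj_eq : ∀ t ∈ Icc a b, B.proj (γ t) = c t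

/-- The curve `c` has a horizontal lift over `[a, b]` from every starting point over `c a`. -/
def HasLifts (A : Connection B) (c : ℝ → M) (a b : ℝ) : Prop :=
  ∀ p, B.proj p = c a → ∃ γ, γ a = p ∧ A.IsLift c γ a b

variable {A : Connection B}

theorem formAt_velocity_congr {γ γ' : ℝ → P} {t : ℝ} (h : γ' =ᶠ[𝓝 t] γ) :
    A.formAt (γ' t) (velocity EP γ' t) = A.formAt (γ t) (velocity EP γ t) := by
  rw [velocity_congr h, h.eq_of_nhds]

theorem IsHorizontalOn.mono {γ : ℝ → P} {a b a' b' : ℝ} (h : A.IsHorizontalOn γ a b)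
    (ha : a ≤ a') (hb : b' ≤ b) : A.IsHorizontalOn γ a' b' :=
  Eventually.mono h fun _ hγ ht => hγ (Ioo_subset_Ioo ha hb ht)

theorem IsHorizontalOn.congr {γ γ' : ℝ → P} {a b : ℝ} (h : A.IsHorizontalOn γ a b)
    (heq : EqOn γ' γ (Ioo a b)) : A.IsHorizontalOn γ' a b :=
  Eventually.mono h fun t hγ ht => by
    rw [formAt_velocity_congr (heq.eventuallyEq_of_mem (isOpen_Ioo.mem_nhds ht)), hγ ht]

theorem IsHorizontalOn.of_split {γ : ℝ → P} {a v b : ℝ} (h : A.IsHorizontalOn γ a v)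
    (h' : A.IsHorizontalOn γ v b) : A.IsHorizontalOn γ a b := by
  filter_upwards [h, h', eventually_cofinite_ne v] with t hl hr hne ht
  exact hne.lt_or_gt.elim (fun htv => hl ⟨ht.1, htv⟩) fun hvt => hr ⟨hvt, ht.2⟩

theorem IsHorizontalOn.translate {γ : ℝ → P} {a b : ℝ} (h : A.IsHorizontalOn γ a b)
    (hγ : PiecewiseC1 EP γ a b) (g : G) : A.IsHorizontalOn (fun t => B.act (γ t) g) a b := by
  filter_upwards [h, hγ.eventually_cofinite_mdifferentiableAt] with t hhor hdiff ht
  rw [velocity_comp (B.mdifferentiable_translate g _) (hdiff ht), A.formAt_translate, hhor ht,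
    map_zero]

theorem IsLift.mono {c : ℝ → M} {γ : ℝ → P} {a b a' b' : ℝ} (h : A.IsLift c γ a b)
    (ha : a ≤ a') (hb : b' ≤ b) : A.IsLift c γ a' b' where
  piecewiseC1 := h.piecewiseC1.mono ha hb
  horizontal := h.horizontal.mono ha hb
  proj_eq t ht := h.proj_eq t (Icc_subset_Icc ha hb ht)

theorem IsLift.congr {c c' : ℝ → M} {γ γ' : ℝ → P} {a b : ℝ} (h : A.IsLift c γ a b)
    (hc : EqOn c' c (Icc a b)) (hγ : EqOn γ' γ (Icc a b)) : A.IsLift c' γ' a b where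
  piecewiseC1 := h.piecewiseC1.congr hγ
  horizontal := h.horizontal.congr (hγ.mono Ioo_subset_Icc_self)
  proj_eq t ht := by rw [hγ ht, hc ht, h.proj_eq t ht]

theorem IsLift.translate {c : ℝ → M} {γ : ℝ → P} {a b : ℝ} (h : A.IsLift c γ a b) (g : G) :
    A.IsLift c (fun t => B.act (γ t) g) a b where
  piecewiseC1 := h.piecewiseC1.comp (F := fun p => B.act p g)
    ((B.contMDiff_translate g).of_le (by exact_mod_cast le_top))
  horizontal := h.horizontal.translate h.piecewiseC1 g
  proj_eq t ht := (B.proj_act _ g).trans (h.proj_eq t ht)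

theorem IsLift.piecewise {c : ℝ → M} {γ γ' : ℝ → P} {a v b : ℝ} (h : A.IsLift c γ a v)
    (h' : A.IsLift c γ' v b) (hv : γ v = γ' v) : A.IsLift c ((Iic v).piecewise γ γ') a b := by
  have heq : EqOn ((Iic v).piecewise γ γ') γ (Icc a v) :=
    (piecewise_eqOn _ _ _).mono Icc_subset_Iic_self
  have heq' : EqOn ((Iic v).piecewise γ γ') γ' (Icc v b) :=
    (eqOn_piecewise_Iic hv).mono Icc_subset_Ici_self
  refine ⟨h.piecewiseC1.piecewise h'.piecewiseC1 hv, ?_, fun t ht => ?_⟩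
  · exact (h.horizontal.congr (heq.mono Ioo_subset_Icc_self)).of_split
      (h'.horizontal.congr (heq'.mono Ioo_subset_Icc_self))
  · rcases le_total t v with htv | htv
    · rw [heq ⟨ht.1, htv⟩, h.proj_eq t ⟨ht.1, htv⟩]
    · rw [heq' ⟨htv, ht.2⟩, h'.proj_eq t ⟨htv, ht.2⟩]

theorem IsLift.hasLifts {c : ℝ → M} {γ : ℝ → P} {a b : ℝ} (hab : a ≤ b) (h : A.IsLift c γ a b) :
    A.HasLifts c a b := fun _ hp => by
  obtain ⟨g, hg⟩ := B.exists_act_eq ((h.proj_eq a (left_mem_Icc.2 hab)).trans hp.symm)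
  exact ⟨_, hg, h.translate g⟩

theorem HasLifts.trans {c : ℝ → M} {a v b : ℝ} (hav : a ≤ v) (h : A.HasLifts c a v)
    (h' : A.HasLifts c v b) : A.HasLifts c a b := fun p hp => by
  obtain ⟨γ, hγa, hγ⟩ := h p hp
  obtain ⟨γ', hγv, hγ'⟩ := h' (γ v) (hγ.proj_eq v (right_mem_Icc.2 hav))
  exact ⟨_, (piecewise_eq_of_mem (Iic v) _ _ hav).trans hγa, hγ.piecewise hγ' hγv.symm⟩

theorem hasLifts_refl (A : Connection B) (c : ℝ → M) (a : ℝ) : A.HasLifts c a a := fun p hp =>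
  ⟨fun _ => p, rfl, .of_contMDiffOn contMDiffOn_const, .of_forall (by simp), by simpa using hp⟩

theorem exists_continuous_eqOn_formAt_velocity (A : Connection B) {σ : ℝ → P} {a b : ℝ}
    (hab : a < b) (hσ : ContMDiffOn 𝓘(ℝ, ℝ) 𝓘(ℝ, EP) 1 σ (Icc a b)) :
    ∃ ξ : ℝ → EG, Continuous ξ ∧ EqOn ξ (fun t => A.formAt (σ t) (velocity EP σ t)) (Ioo a b) := by
  have htangent := hσ.continuousOn_tangentMapWithin le_rfl (uniqueDiffOn_Icc hab).uniqueMDiffOn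
  have hunit : Continuous fun t : ℝ => (⟨t, (1 : ℝ)⟩ : TangentBundle 𝓘(ℝ, ℝ) ℝ) :=
    (tangentBundleModelSpaceHomeomorph 𝓘(ℝ, ℝ)).symm.continuous.comp
      (continuous_id.prodMk (continuous_const (y := (1 : ℝ))))
  have hform := A.contMDiff_form.continuous.comp_continuousOn
    (htangent.comp hunit.continuousOn (s := Icc a b) fun _ ht => ht)
  refine ⟨_, hform.domRestrict.Icc_extend' (h := hab.le), fun t ht => ?_⟩
  rw [IccExtend_of_mem _ _ (Ioo_subset_Icc_self ht)]
  change A.formAt (σ t) (mfderivWithin 𝓘(ℝ, ℝ) 𝓘(ℝ, EP) σ (Icc a b) t (1 : ℝ)) = _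
  rw [mfderivWithin_of_mem_nhds (Icc_mem_nhds ht.1 ht.2)]
  rfl

variable [LieGroup 𝓘(ℝ, EG) ∞ G] [CompleteSpace EG]

theorem exists_eventually_formAt_velocity_act_eq_zero (A : Connection B) {σ : ℝ → P} {a b : ℝ}
    (hab : a < b) (hσ : ContMDiffOn 𝓘(ℝ, ℝ) 𝓘(ℝ, EP) 1 σ (Icc a b)) (t₀ : ℝ) :
    ∃ g : ℝ → G, ∀ᶠ t in 𝓝 t₀, ContMDiffAt 𝓘(ℝ, ℝ) 𝓘(ℝ, EG) 1 g t ∧ (t ∈ Ioo a b →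
      A.formAt (B.act (σ t) (g t)) (velocity EP (fun t => B.act (σ t) (g t)) t) = 0) := by
  obtain ⟨ξ, hξ, hξσ⟩ := A.exists_continuous_eqOn_formAt_velocity hab hσ
  obtain ⟨g, -, hg⟩ := exists_velocity_eq_tderiv_mul_right (G := G) hξ.neg t₀
  refine ⟨g, hg.mono fun t ⟨hgt, hvel⟩ => ⟨hgt, fun ht => ?_⟩⟩
  have hξt : ξ t = A.formAt (σ t) (velocity EP σ t) := hξσ ht
  have hσt := (hσ.contMDiffAt (Icc_mem_nhds ht.1 ht.2)).mdifferentiableAt one_ne_zero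
  rw [B.velocity_act hσt (hgt.mdifferentiableAt one_ne_zero), map_add, A.formAt_translate, hvel,
    A.formAt_tderiv_orbit_mul_right, ← hξt, ← map_add]
  exact (congrArg _ (add_neg_cancel (ξ t))).trans (map_zero _)

theorem hasLifts_proj_comp (A : Connection B) {σ : ℝ → P} {a b : ℝ} (hab : a ≤ b)
    (hσ : ContMDiffOn 𝓘(ℝ, ℝ) 𝓘(ℝ, EP) 1 σ (Icc a b)) :
    A.HasLifts (fun t => B.proj (σ t)) a b := by
  rcases hab.eq_or_lt with rfl | hlt
  · exact A.hasLifts_refl _ _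
  refine interval_induction hab (fun u v w huv _ => HasLifts.trans huv) fun t₀ _ => ?_
  obtain ⟨g, hg⟩ := A.exists_eventually_formAt_velocity_act_eq_zero hlt hσ t₀
  refine ⟨_, hg, fun u v huv hsub => IsLift.hasLifts (γ := fun t => B.act (σ t) (g t)) huv ?_⟩
  have hab' : Icc u v ⊆ Icc a b := fun t ht => (hsub ht).2
  have hsmooth : ContMDiffOn 𝓘(ℝ, ℝ) 𝓘(ℝ, EP) 1 (fun t => B.act (σ t) (g t)) (Icc u v) :=
    (B.contMDiff_act.of_le (by exact_mod_cast le_top)).comp_contMDiffOn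
      ((hσ.mono hab').prodMk fun t ht => (hsub ht).1.1.contMDiffWithinAt)
  refine ⟨.of_contMDiffOn hsmooth, .of_forall fun t ht => ?_, fun t _ => B.proj_act _ _⟩
  exact (hsub (Ioo_subset_Icc_self ht)).1.2 ⟨(hab' (left_mem_Icc.2 huv)).1.trans_lt ht.1,
    ht.2.trans_le (hab' (right_mem_Icc.2 huv)).2⟩

theorem hasLifts_of_contMDiffOn (A : Connection B) {c : ℝ → M} {a b : ℝ} (hab : a ≤ b)
    (hc : ContMDiffOn 𝓘(ℝ, ℝ) 𝓘(ℝ, EM) 1 c (Icc a b)) : A.HasLifts c a b := by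
  refine interval_induction hab (fun u v w huv _ => HasLifts.trans huv) fun t ht => ?_
  obtain ⟨U, hU, σ, -, hσ, -, hproj, -⟩ := B.exists_local_section (c t)
  obtain ⟨W, hW, hWU⟩ := mem_nhdsWithin_iff_exists_mem_nhds_inter.1 (hc.continuousOn t ht hU)
  refine ⟨W, hW, fun u v huv hsub p hp => ?_⟩
  have hlifts := A.hasLifts_proj_comp huv <| (hσ.of_le (by exact_mod_cast le_top)).comp
    (hc.mono fun s hs => (hsub hs).2) fun s hs => hWU (hsub hs)
  have hsection : EqOn (fun s => B.proj (σ (c s))) c (Icc u v) := fun s hs =>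
    hproj _ (hWU (hsub hs))
  obtain ⟨γ, hγu, hγ⟩ := hlifts p (hp.trans (hsection (left_mem_Icc.2 huv)).symm)
  exact ⟨γ, hγu, hγ.congr hsection.symm (eqOn_refl _ _)⟩

theorem hasLifts_of_piecewiseC1 (A : Connection B) {c : ℝ → M} {a b : ℝ} (hab : a ≤ b)
    (hc : PiecewiseC1 EM c a b) : A.HasLifts c a b :=
  hc.induction hab (fun _ _ _ huv _ => HasLifts.trans huv) fun _ _ huv _ =>
    A.hasLifts_of_contMDiffOn huv

end Connection

end HorizontalLift

section Uniqueness

section ConstantCurve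

variable {E X : Type*} [NormedAddCommGroup E] [NormedSpace ℝ E]
  [TopologicalSpace X] [ChartedSpace E X] [IsManifold 𝓘(ℝ, E) ∞ X]

theorem hasDerivAt_extChartAt_comp_of_velocity_eq_zero {g : ℝ → X} {x : X} {t : ℝ}
    (hx : g t ∈ (extChartAt 𝓘(ℝ, E) x).source) (hg : MDifferentiableAt 𝓘(ℝ, ℝ) 𝓘(ℝ, E) g t)
    (h : velocity E g t = 0) : HasDerivAt (fun s => extChartAt 𝓘(ℝ, E) x (g s)) 0 t := by
  have hchart := (contMDiffAt_extChartAt_of_mem_source hx).mdifferentiableAt (by simp)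
  have hderiv := velocity_comp hchart hg
  rw [h, map_zero, velocity_eq_deriv] at hderiv
  exact hderiv ▸ (mdifferentiableAt_iff_differentiableAt.1 (hchart.comp t hg)).hasDerivAt

variable [CompleteSpace E]

theorem eq_of_eventually_cofinite_hasDerivAt_zero {f : ℝ → E} {a b : ℝ} (hab : a ≤ b)
    (hf : ContinuousOn f (Icc a b)) (h : ∀ᶠ t in cofinite, t ∈ Ioo a b → HasDerivAt f 0 t) :
    f a = f b := by
  have hintegral := MeasureTheory.integral_eq_of_hasDerivAt_off_countable_of_le f
    (fun _ => (0 : E)) hab (eventually_cofinite.1 h).countable hf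
    (fun t ht => not_not.1 ht.2 ht.1) (by simp)
  rw [intervalIntegral.integral_zero] at hintegral
  exact (sub_eq_zero.1 hintegral.symm).symm

theorem eq_of_eventually_cofinite_velocity_eq_zero {g : ℝ → X} {a b : ℝ} (hab : a ≤ b)
    (hg : ContinuousOn g (Icc a b)) (h : ∀ᶠ t in cofinite, t ∈ Ioo a b →
      MDifferentiableAt 𝓘(ℝ, ℝ) 𝓘(ℝ, E) g t ∧ velocity E g t = 0) : g a = g b := by
  refine interval_induction hab (Q := fun u v => g u = g v) (fun _ _ _ _ _ => Eq.trans)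
    fun t ht => ?_
  obtain ⟨W, hW, hsource⟩ := mem_nhdsWithin_iff_exists_mem_nhds_inter.1
    (hg t ht (extChartAt_source_mem_nhds (I := 𝓘(ℝ, E)) (g t)))
  refine ⟨W, hW, fun u v huv hsub => ?_⟩
  have hab' : Icc u v ⊆ Icc a b := fun s hs => (hsub hs).2
  refine (extChartAt 𝓘(ℝ, E) (g t)).injOn (hsource (hsub (left_mem_Icc.2 huv)))
    (hsource (hsub (right_mem_Icc.2 huv))) <| eq_of_eventually_cofinite_hasDerivAt_zero huv
      ((continuousOn_extChartAt (g t)).comp (hg.mono hab') fun s hs => hsource (hsub hs)) ?_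
  filter_upwards [h] with s hzero hs
  obtain ⟨hdiff, hvel⟩ := hzero ⟨(hab' (left_mem_Icc.2 huv)).1.trans_lt hs.1,
    hs.2.trans_le (hab' (right_mem_Icc.2 huv)).2⟩
  exact hasDerivAt_extChartAt_comp_of_velocity_eq_zero
    (hsource (hsub (Ioo_subset_Icc_self hs))) hdiff hvel

end ConstantCurve

variable {EG EP EM G P M : Type*}
  [NormedAddCommGroup EG] [NormedSpace ℝ EG] [CompleteSpace EG]
  [NormedAddCommGroup EP] [NormedSpace ℝ EP] [NormedAddCommGroup EM] [NormedSpace ℝ EM]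
  [TopologicalSpace G] [ChartedSpace EG G] [Group G] [LieGroup 𝓘(ℝ, EG) ∞ G]
  [TopologicalSpace P] [ChartedSpace EP P] [TopologicalSpace M] [ChartedSpace EM M]
  [IsManifold 𝓘(ℝ, EP) ∞ P] {B : PrincipalBundle EG EP EM G P M} {A : Connection B}

theorem Connection.IsLift.apply_eq {c : ℝ → M} {γ γ' : ℝ → P} {a b : ℝ} (hab : a ≤ b)
    (h : A.IsLift c γ a b) (h' : A.IsLift c γ' a b) (ha : γ a = γ' a) : γ b = γ' b := by
  have : IsManifold 𝓘(ℝ, EG) ∞ G := LieGroup.toContMDiffMul.toIsManifold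
  have hproj (t) (ht : t ∈ Icc a b) : B.proj (γ t) = B.proj (γ' t) :=
    (h.proj_eq t ht).trans (h'.proj_eq t ht).symm
  suffices hdiv : B.div (γ a) (γ' a) = B.div (γ b) (γ' b) by
    rw [← B.act_div (hproj b (right_mem_Icc.2 hab)), ← hdiv, ← ha, B.div_self, B.act_one]
  refine eq_of_eventually_cofinite_velocity_eq_zero (E := EG)
    (g := fun t => B.div (γ t) (γ' t)) hab (B.continuousOn_div h.piecewiseC1.continuousOn
      h'.piecewiseC1.continuousOn hproj) ?_
  filter_upwards [h.horizontal, h'.horizontal, h.piecewiseC1.eventually_cofinite_mdifferentiableAt,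
    h'.piecewiseC1.eventually_cofinite_mdifferentiableAt] with t hhor hhor' hdiff hdiff' ht
  have hnear : ∀ᶠ s in 𝓝 t, B.proj (γ s) = B.proj (γ' s) := by
    filter_upwards [Icc_mem_nhds ht.1 ht.2] with s hs using hproj s hs
  have hdiv := B.mdifferentiableAt_div (hdiff ht) (hdiff' ht) hnear
  have hact : (fun s => B.act (γ s) (B.div (γ s) (γ' s))) =ᶠ[𝓝 t] γ' :=
    hnear.mono fun s hs => B.act_div hs
  exact ⟨hdiv, A.velocity_eq_zero_of_formAt_eq_zero (hdiff ht) hdiv (hhor ht)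
    ((formAt_velocity_congr hact).trans (hhor' ht))⟩

theorem Connection.IsLift.eqOn {c : ℝ → M} {γ γ' : ℝ → P} {a b : ℝ} (h : A.IsLift c γ a b)
    (h' : A.IsLift c γ' a b) (ha : γ a = γ' a) : EqOn γ γ' (Icc a b) := fun _ ht =>
  (h.mono le_rfl ht.2).apply_eq ht.1 (h'.mono le_rfl ht.2) ha

end Uniqueness

section Reparametrization

theorem eventually_cofinite_Ioo_comp {φ : ℝ → ℝ} {a b a' b' : ℝ} (hφ : InjOn φ (Ioo a' b'))
    (hmaps : MapsTo φ (Ioo a' b') (Ioo a b)) {p : ℝ → Prop}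
    (h : ∀ᶠ s in cofinite, s ∈ Ioo a b → p s) : ∀ᶠ t in cofinite, t ∈ Ioo a' b' → p (φ t) := by
  refine eventually_cofinite.2 (Finite.of_finite_image (f := φ) ?_ (hφ.mono fun t ht => ?_))
  · refine (eventually_cofinite.1 h).subset ?_
    rintro _ ⟨t, ht, rfl⟩
    obtain ⟨hmem, hnot⟩ := Classical.not_imp.1 ht
    exact Classical.not_imp.2 ⟨hmaps hmem, hnot⟩
  · exact (Classical.not_imp.1 ht).1

theorem PiecewiseC1.comp_strictMonoOn {E X : Type*} [NormedAddCommGroup E] [NormedSpace ℝ E]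
    [TopologicalSpace X] [ChartedSpace E X] {f : ℝ → X} {φ : ℝ → ℝ} {a b : ℝ}
    (hf : PiecewiseC1 E f (φ a) (φ b)) (hφ : PiecewiseC1 ℝ φ a b)
    (hmono : StrictMonoOn φ (Icc a b)) : PiecewiseC1 E (fun t => f (φ t)) a b := by
  classical
  have hcont := hφ.continuousOn
  obtain ⟨S, hS⟩ := hf
  obtain ⟨T, hT⟩ := hφ
  have hfin : (Icc a b ∩ φ ⁻¹' S).Finite :=
    (S.finite_toSet.subset (image_subset_iff.2 inter_subset_right)).of_finite_image
      (hmono.injOn.mono inter_subset_left)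
  refine ⟨T ∪ hfin.toFinset, fun u v hu hv hbreak => ?_⟩
  rcases lt_or_ge v u with hvu | huv
  · simp only [Icc_eq_empty_of_lt hvu, contMDiffOn_empty]
  have hsub : Icc u v ⊆ Icc a b := Icc_subset_Icc hu hv
  have hau := hmono.monotoneOn (left_mem_Icc.2 (hu.trans (huv.trans hv)))
    (hsub (left_mem_Icc.2 huv)) hu
  have hvb := hmono.monotoneOn (hsub (right_mem_Icc.2 huv))
    (right_mem_Icc.2 (hu.trans (huv.trans hv))) hv
  refine (hS (φ u) (φ v) hau hvb fun s hs hsuv => ?_).comp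
    (hT u v hu hv fun s hs => hbreak s (Finset.mem_union_left _ hs))
    (hmono.monotoneOn.mono hsub).mapsTo_Icc
  obtain ⟨t, ht, rfl⟩ := intermediate_value_Ioo huv (hcont.mono hsub) hsuv
  exact hbreak t (Finset.mem_union_right _
    (hfin.mem_toFinset.2 ⟨hsub (Ioo_subset_Icc_self ht), hs⟩)) ht

theorem glue_eq_piecewise {X : Type*} (l : ℝ) (f g : ℝ → X) :
    glue l f g = (Iic l).piecewise f fun t => g (t - l) := rfl

variable {EG EP EM G P M : Type*}
  [NormedAddCommGroup EG] [NormedSpace ℝ EG] [NormedAddCommGroup EP] [NormedSpace ℝ EP]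
  [NormedAddCommGroup EM] [NormedSpace ℝ EM]
  [TopologicalSpace G] [ChartedSpace EG G] [Group G]
  [TopologicalSpace P] [ChartedSpace EP P] [TopologicalSpace M] [ChartedSpace EM M]
  [IsManifold 𝓘(ℝ, EP) ∞ P] {B : PrincipalBundle EG EP EM G P M} {A : Connection B}

theorem Connection.IsHorizontalOn.comp {γ : ℝ → P} {φ : ℝ → ℝ} {a b a' b' : ℝ}
    (h : A.IsHorizontalOn γ a b) (hγ : PiecewiseC1 EP γ a b) (hφ : PiecewiseC1 ℝ φ a' b')
    (hinj : InjOn φ (Ioo a' b')) (hmaps : MapsTo φ (Ioo a' b') (Ioo a b)) :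
    A.IsHorizontalOn (fun t => γ (φ t)) a' b' := by
  filter_upwards [eventually_cofinite_Ioo_comp hinj hmaps h,
    eventually_cofinite_Ioo_comp hinj hmaps hγ.eventually_cofinite_mdifferentiableAt,
    hφ.eventually_cofinite_mdifferentiableAt] with t hhor hdiff hdiffφ ht
  have hchain : velocity EP (fun s => γ (φ s)) t = velocity ℝ φ t • velocity EP γ (φ t) := by
    rw [velocity_comp (F := γ) (hdiff ht) (hdiffφ ht)]
    exact (congrArg _ (mul_one _).symm).trans (map_smul _ (velocity ℝ φ t) (1 : ℝ))
  rw [hchain, map_smul, hhor ht, smul_zero]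

theorem Connection.IsLift.comp_strictMonoOn {c : ℝ → M} {γ : ℝ → P} {φ : ℝ → ℝ} {a b : ℝ}
    (h : A.IsLift c γ (φ a) (φ b)) (hφ : PiecewiseC1 ℝ φ a b) (hmono : StrictMonoOn φ (Icc a b)) :
    A.IsLift (fun t => c (φ t)) (fun t => γ (φ t)) a b where
  piecewiseC1 := h.piecewiseC1.comp_strictMonoOn hφ hmono
  horizontal := h.horizontal.comp h.piecewiseC1 hφ (hmono.injOn.mono Ioo_subset_Icc_self)
    hmono.mapsTo_Ioo
  proj_eq _ ht := h.proj_eq _ (hmono.monotoneOn.mapsTo_Icc ht)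

theorem Connection.IsLift.reverse {c : ℝ → M} {γ : ℝ → P} {l : ℝ} (h : A.IsLift c γ 0 l) :
    A.IsLift (fun t => c (l - t)) (fun t => γ (l - t)) 0 l where
  piecewiseC1 := h.piecewiseC1.reverse
  horizontal := h.horizontal.comp h.piecewiseC1
    (.of_contMDiff (contDiff_const.sub contDiff_id).contMDiff _ _) (sub_right_injective.injOn)
    fun _ ht => ⟨sub_pos.2 ht.2, sub_lt_self l ht.1⟩
  proj_eq _ ht := h.proj_eq _ ⟨sub_nonneg.2 ht.2, sub_le_self l ht.1⟩

theorem Connection.IsLift.glue {c c' : ℝ → M} {γ γ' : ℝ → P} {l l' : ℝ} (hl : 0 ≤ l)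
    (hl' : 0 ≤ l') (h : A.IsLift c γ 0 l) (h' : A.IsLift c' γ' 0 l') (heq : γ l = γ' 0) :
    A.IsLift (glue l c c') (glue l γ γ') 0 (l + l') := by
  have hc : c l = c' 0 := by
    rw [← h.proj_eq l (right_mem_Icc.2 hl), heq, h'.proj_eq 0 (left_mem_Icc.2 hl')]
  have hshift : A.IsLift (fun t => c' (t - l)) (fun t => γ' (t - l)) l (l + l') :=
    IsLift.comp_strictMonoOn (φ := fun t => t - l) (by simpa using h')
      (.of_contMDiff (contDiff_id.sub contDiff_const).contMDiff _ _)
      fun _ _ _ _ h => sub_lt_sub_right h l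
  have hright : EqOn ((Iic l).piecewise c fun t => c' (t - l)) (fun t => c' (t - l))
      (Icc l (l + l')) :=
    (eqOn_piecewise_Iic (by simpa using hc)).mono Icc_subset_Ici_self
  rw [glue_eq_piecewise, glue_eq_piecewise]
  exact IsLift.piecewise (h.congr ((piecewise_eqOn _ _ _).mono Icc_subset_Iic_self) fun _ _ => rfl)
    (hshift.congr hright fun _ _ => rfl) (by simpa using heq)

end Reparametrization

section Backtracking

variable {E X : Type*} [NormedAddCommGroup E] [NormedSpace ℝ E]
  [TopologicalSpace X] [ChartedSpace E X] {x y : X} {c c' : PwPath E x y}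

theorem PwPath.ElemBacktrack.symm (h : PwPath.ElemBacktrack c c') : PwPath.ElemBacktrack c' c := by
  obtain ⟨u, v, a, d, b, h⟩ := h
  exact ⟨u, v, a, d, b, h.symm⟩

theorem BtPath.mk_eq_of_elemBacktrack (h : PwPath.ElemBacktrack c c') :
    BtPath.mk c = BtPath.mk c' :=
  Quotient.sound (Relation.EqvGen.rel _ _ h)

theorem BtPath.mk_eq_of_isReparam (h : PwPath.IsReparam c c') : BtPath.mk c = BtPath.mk c' :=
  mk_eq_of_elemBacktrack (.of_isReparam h)

end Backtracking

section PathLift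

variable {EG EP EM G P M : Type*}
  [NormedAddCommGroup EG] [NormedSpace ℝ EG] [NormedAddCommGroup EP] [NormedSpace ℝ EP]
  [NormedAddCommGroup EM] [NormedSpace ℝ EM]
  [TopologicalSpace G] [ChartedSpace EG G] [Group G]
  [TopologicalSpace P] [ChartedSpace EP P] [TopologicalSpace M] [ChartedSpace EM M]
  [IsManifold 𝓘(ℝ, EP) ∞ P] {B : PrincipalBundle EG EP EM G P M}

namespace Connection

/-- The path `γ` on `P` is a horizontal lift of the path `c` on `M`, with the same domain. -/
structure IsPathLift (A : Connection B) {x y : M} {p q : P} (c : PwPath EM x y)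
    (γ : PwPath EP p q) : Prop where
  len_eq : γ.len = c.len
  isLift : A.IsLift c.toFun γ.toFun 0 c.len

/-- The backtrack equivalence classes of the horizontal lifts of `c` from `p` to `q`. -/
def liftClasses (A : Connection B) {x y : M} (c : PwPath EM x y) (p q : P) : Set (BtPath EP p q) :=
  {f | ∃ γ, A.IsPathLift c γ ∧ BtPath.mk γ = f}

variable {A : Connection B} {x y z : M} {p q r : P}

theorem isHorizontalPath_iff {γ : PwPath EP p q} :
    A.IsHorizontalPath γ ↔ A.IsHorizontalOn γ.toFun 0 γ.len := by
  refine ⟨fun ⟨S, hS⟩ => S.eventually_cofinite_notMem.mono fun t hts ht => hS t ht hts, fun h => ?_⟩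
  have hfin := eventually_cofinite.1 h
  refine ⟨hfin.toFinset, fun t ht hts => ?_⟩
  have himp : ¬¬(t ∈ Ioo 0 γ.len → _) := fun hn => hts (hfin.mem_toFinset.2 hn)
  exact not_not.1 himp ht

namespace IsPathLift

theorem trans {c : PwPath EM x y} {d : PwPath EM y z} {γ : PwPath EP p q} {δ : PwPath EP q r}
    (h : A.IsPathLift c γ) (h' : A.IsPathLift d δ) : A.IsPathLift (c.trans d) (γ.trans δ) where
  len_eq := congrArg₂ (· + ·) h.len_eq h'.len_eq
  isLift := by
    have hglue : (γ.trans δ).toFun = glue c.len γ.toFun δ.toFun := h.len_eq ▸ rfl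
    rw [hglue]
    exact h.isLift.glue c.len_nonneg d.len_nonneg h'.isLift (by rw [← h.len_eq, γ.target, δ.source])

theorem symm {c : PwPath EM x y} {γ : PwPath EP p q} (h : A.IsPathLift c γ) :
    A.IsPathLift c.symm γ.symm where
  len_eq := h.len_eq
  isLift := by
    have hreverse : γ.symm.toFun = fun t => γ.toFun (c.len - t) := h.len_eq ▸ rfl
    rw [hreverse]
    exact h.isLift.reverse

theorem isHorizontalPath {c : PwPath EM x y} {γ : PwPath EP p q} (h : A.IsPathLift c γ) :
    A.IsHorizontalPath γ :=
  isHorizontalPath_iff.2 (h.len_eq ▸ h.isLift.horizontal)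

theorem proj_source {c : PwPath EM x y} {γ : PwPath EP p q} (h : A.IsPathLift c γ) :
    B.proj p = x := by
  rw [← γ.source, h.isLift.proj_eq 0 (left_mem_Icc.2 c.len_nonneg), c.source]

theorem proj_target {c : PwPath EM x y} {γ : PwPath EP p q} (h : A.IsPathLift c γ) :
    B.proj q = y := by
  rw [← γ.target, h.len_eq, h.isLift.proj_eq _ (right_mem_Icc.2 c.len_nonneg), c.target]

end IsPathLift

theorem isPathLift_map (hB : ContMDiff 𝓘(ℝ, EP) 𝓘(ℝ, EM) 1 B.proj) {γ : PwPath EP p q}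
    (h : A.IsHorizontalPath γ) : A.IsPathLift (γ.map hB) γ :=
  ⟨rfl, γ.piecewiseC1, isHorizontalPath_iff.1 h, fun _ _ => rfl⟩

variable [LieGroup 𝓘(ℝ, EG) ∞ G] [CompleteSpace EG]

theorem exists_isPathLift (A : Connection B) (c : PwPath EM x y) (hp : B.proj p = x) :
    ∃ (q : P) (γ : PwPath EP p q), A.IsPathLift c γ := by
  obtain ⟨γ, hsource, h⟩ :=
    A.hasLifts_of_piecewiseC1 c.len_nonneg c.piecewiseC1 p (hp.trans c.source.symm)
  exact ⟨γ c.len, ⟨c.len, γ, c.len_nonneg, hsource, rfl, h.piecewiseC1⟩, rfl, h⟩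

namespace IsPathLift

variable {c c' : PwPath EM x y} {γ : PwPath EP p q}

theorem eqOn_comp {γ' : PwPath EP p r} {φ : ℝ → ℝ} (h : A.IsPathLift c γ)
    (h' : A.IsPathLift c' γ') (hφ : PiecewiseC1 ℝ φ 0 c'.len)
    (hmono : StrictMonoOn φ (Icc 0 c'.len)) (hzero : φ 0 = 0) (hlen : φ c'.len = c.len)
    (heq : EqOn c'.toFun (c.toFun ∘ φ) (Icc 0 c'.len)) :
    EqOn γ'.toFun (γ.toFun ∘ φ) (Icc 0 c'.len) := by
  have hlift : A.IsLift c.toFun γ.toFun (φ 0) (φ c'.len) := by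
    rw [hzero, hlen]
    exact h.isLift
  exact h'.isLift.eqOn ((hlift.comp_strictMonoOn hφ hmono).congr heq fun _ _ => rfl)
    (by rw [γ'.source, Function.comp_apply, hzero, γ.source])

theorem target_eq {γ' : PwPath EP p r} (h : A.IsPathLift c γ) (h' : A.IsPathLift c' γ')
    (hc : PwPath.IsReparam c' c) : r = q := by
  obtain ⟨φ, hmono, hφ, hzero, hlen, heq⟩ := hc
  have hend := h.eqOn_comp h' hφ hmono hzero hlen heq (right_mem_Icc.2 c'.len_nonneg)
  rwa [Function.comp_apply, hlen, ← h.len_eq, ← h'.len_eq, γ.target, γ'.target] at hend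

theorem isReparam {γ' : PwPath EP p q} (h : A.IsPathLift c γ) (h' : A.IsPathLift c' γ')
    (hc : PwPath.IsReparam c' c) : PwPath.IsReparam γ' γ := by
  obtain ⟨φ, hmono, hφ, hzero, hlen, heq⟩ := hc
  have hend := h.eqOn_comp h' hφ hmono hzero hlen heq
  rw [← h'.len_eq] at hmono hφ hend hlen
  exact ⟨φ, hmono, hφ, hzero, hlen.trans h.len_eq.symm, hend⟩

theorem exists_elemBacktrack (h : A.IsPathLift c γ) (hc : PwPath.ElemBacktrack c c') :
    ∃ γ' : PwPath EP p q, A.IsPathLift c' γ' ∧ PwPath.ElemBacktrack γ γ' := by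
  obtain ⟨_, _, a, d, b, hc⟩ := hc
  obtain ⟨u, a', ha⟩ := A.exists_isPathLift a h.proj_source
  obtain ⟨v, d', hd⟩ := A.exists_isPathLift d ha.proj_target
  obtain ⟨_, b', hb⟩ := A.exists_isPathLift b ha.proj_target
  have hlong := ha.trans (hd.trans (hd.symm.trans hb))
  have hshort := ha.trans hb
  obtain ⟨_, γ', hγ'⟩ := A.exists_isPathLift c' h.proj_source
  rcases hc with ⟨hlc, hsc'⟩ | ⟨hlc', hsc⟩
  · obtain rfl := h.target_eq hlong hlc
    obtain rfl := hγ'.target_eq hshort hsc'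
    exact ⟨γ', hγ', u, v, a', d', b',
      .inl ⟨h.isReparam hlong hlc, hγ'.isReparam hshort hsc'⟩⟩
  · obtain rfl := h.target_eq hshort hsc
    obtain rfl := hγ'.target_eq hlong hlc'
    exact ⟨γ', hγ', u, v, a', d', b',
      .inr ⟨hγ'.isReparam hlong hlc', h.isReparam hshort hsc⟩⟩

end IsPathLift

theorem liftClasses_subset_of_elemBacktrack (A : Connection B) {c c' : PwPath EM x y}
    (h : PwPath.ElemBacktrack c c') (p q : P) : A.liftClasses c p q ⊆ A.liftClasses c' p q := by
  rintro _ ⟨γ, hγ, rfl⟩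
  obtain ⟨γ', hγ', hback⟩ := hγ.exists_elemBacktrack h
  exact ⟨γ', hγ', (BtPath.mk_eq_of_elemBacktrack hback).symm⟩

theorem liftClasses_eq_of_mk_eq (A : Connection B) {c c' : PwPath EM x y}
    (h : BtPath.mk c = BtPath.mk c') (p q : P) : A.liftClasses c p q = A.liftClasses c' p q :=
  Setoid.eqvGen_le (s := Setoid.ker fun c : PwPath EM x y => A.liftClasses c p q)
    (fun _ _ h => (A.liftClasses_subset_of_elemBacktrack h p q).antisymm
      (A.liftClasses_subset_of_elemBacktrack h.symm p q)) (Quotient.exact h)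

end Connection

end PathLift

section PathFunctors

theorem PathCat.map_congr {E E' X Y : Type*} [NormedAddCommGroup E] [NormedSpace ℝ E]
    [NormedAddCommGroup E'] [NormedSpace ℝ E'] [TopologicalSpace X] [ChartedSpace E X]
    [TopologicalSpace Y] [ChartedSpace E' Y] {F F' : X → Y} (h : F = F')
    (hF : ContMDiff 𝓘(ℝ, E) 𝓘(ℝ, E') 1 F) (hF' : ContMDiff 𝓘(ℝ, E) 𝓘(ℝ, E') 1 F') :
    PathCat.map hF = PathCat.map hF' := by
  subst h
  rfl

theorem PathCat.map_id (E X : Type*) [NormedAddCommGroup E] [NormedSpace ℝ E]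
    [TopologicalSpace X] [ChartedSpace E X] :
    PathCat.map (contMDiff_id (I := 𝓘(ℝ, E)) (M := X)) = 𝟭 (PathCat E X) :=
  Functor.hext (fun _ => rfl) fun _ _ f => by
    induction f using Quotient.inductionOn with
    | h γ => rfl

theorem PathCat.map_comp_map {E E' E'' X Y Z : Type*} [NormedAddCommGroup E] [NormedSpace ℝ E]
    [NormedAddCommGroup E'] [NormedSpace ℝ E'] [NormedAddCommGroup E''] [NormedSpace ℝ E'']
    [TopologicalSpace X] [ChartedSpace E X] [TopologicalSpace Y] [ChartedSpace E' Y]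
    [TopologicalSpace Z] [ChartedSpace E'' Z] {F : X → Y} {F' : Y → Z}
    (hF : ContMDiff 𝓘(ℝ, E) 𝓘(ℝ, E') 1 F) (hF' : ContMDiff 𝓘(ℝ, E') 𝓘(ℝ, E'') 1 F') :
    PathCat.map hF ⋙ PathCat.map hF' = PathCat.map (hF'.comp hF) :=
  Functor.hext (fun _ => rfl) fun _ _ f => by
    induction f using Quotient.inductionOn with
    | h γ => rfl

variable {EG EP EM G P M : Type*}
  [NormedAddCommGroup EG] [NormedSpace ℝ EG] [NormedAddCommGroup EP] [NormedSpace ℝ EP]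
  [NormedAddCommGroup EM] [NormedSpace ℝ EM]
  [TopologicalSpace G] [ChartedSpace EG G] [Group G]
  [TopologicalSpace P] [ChartedSpace EP P] [TopologicalSpace M] [ChartedSpace EM M]

namespace PrincipalBundle

theorem translate_one (B : PrincipalBundle EG EP EM G P M) : B.translate 1 = 𝟭 (PathCat EP P) :=
  (PathCat.map_congr (funext B.act_one) _ _).trans (PathCat.map_id EP P)

theorem translate_comp_translate (B : PrincipalBundle EG EP EM G P M) (g h : G) :
    B.translate g ⋙ B.translate h = B.translate (g * h) :=
  (PathCat.map_comp_map _ _).trans (PathCat.map_congr (funext fun p => B.act_mul p g h) _ _)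

theorem translate_comp_projPath (B : PrincipalBundle EG EP EM G P M) (g : G) :
    B.translate g ⋙ B.projPath = B.projPath :=
  (PathCat.map_comp_map _ _).trans (PathCat.map_congr (funext fun p => B.proj_act p g) _ _)

end PrincipalBundle

end PathFunctors

section Arrows

theorem arrow_mk_comp_congr {C : Type*} [Category C] {a b c a' b' c' : C} {f : a ⟶ b} {g : b ⟶ c}
    {f' : a' ⟶ b'} {g' : b' ⟶ c'} (hf : Arrow.mk f = Arrow.mk f') (hg : Arrow.mk g = Arrow.mk g') :
    Arrow.mk (f ≫ g) = Arrow.mk (f' ≫ g') := by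
  obtain rfl : a = a' := congrArg (fun F : Arrow C => F.left) hf
  obtain rfl : b = b' := congrArg (fun F : Arrow C => F.right) hf
  obtain rfl : c = c' := congrArg (fun F : Arrow C => F.right) hg
  rw [Arrow.mk_injective _ _ hf, Arrow.mk_injective _ _ hg]

/-- A backtrack-erased path as an element of the set of all morphisms of the path category, where
paths with different endpoints can be compared. -/
def BtPath.arrow {E X : Type*} [NormedAddCommGroup E] [NormedSpace ℝ E] [TopologicalSpace X]
    [ChartedSpace E X] {x y : X} (f : BtPath E x y) : Arrow (PathCat E X) :=
  Arrow.mk (X := (x : PathCat E X)) (Y := (y : PathCat E X)) f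

variable {EG EP EM G P M : Type*}
  [NormedAddCommGroup EG] [NormedSpace ℝ EG] [NormedAddCommGroup EP] [NormedSpace ℝ EP]
  [NormedAddCommGroup EM] [NormedSpace ℝ EM]
  [TopologicalSpace G] [ChartedSpace EG G] [Group G]
  [TopologicalSpace P] [ChartedSpace EP P] [TopologicalSpace M] [ChartedSpace EM M]
  (B : PrincipalBundle EG EP EM G P M)

namespace PrincipalBundle

theorem mapArrow_translate_one (F : Arrow (PathCat EP P)) :
    (B.translate 1).mapArrow.obj F = F :=
  congrArg (fun T : PathCat EP P ⥤ PathCat EP P => T.mapArrow.obj F) B.translate_one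

theorem mapArrow_translate_translate (F : Arrow (PathCat EP P)) (g h : G) :
    (B.translate h).mapArrow.obj ((B.translate g).mapArrow.obj F) =
      (B.translate (g * h)).mapArrow.obj F :=
  congrArg (fun T : PathCat EP P ⥤ PathCat EP P => T.mapArrow.obj F)
    (B.translate_comp_translate g h)

theorem mapArrow_projPath_translate (F : Arrow (PathCat EP P)) (g : G) :
    B.projPath.mapArrow.obj ((B.translate g).mapArrow.obj F) = B.projPath.mapArrow.obj F :=
  congrArg (fun T : PathCat EP P ⥤ PathCat EM M => T.mapArrow.obj F) (B.translate_comp_projPath g)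

end PrincipalBundle

end Arrows

section UniqueArrowLift

variable {EG EP EM G P M : Type*}
  [NormedAddCommGroup EG] [NormedSpace ℝ EG] [CompleteSpace EG]
  [NormedAddCommGroup EP] [NormedSpace ℝ EP] [NormedAddCommGroup EM] [NormedSpace ℝ EM]
  [TopologicalSpace G] [ChartedSpace EG G] [Group G] [LieGroup 𝓘(ℝ, EG) ∞ G]
  [TopologicalSpace P] [ChartedSpace EP P] [TopologicalSpace M] [ChartedSpace EM M]
  [IsManifold 𝓘(ℝ, EP) ∞ P] {B : PrincipalBundle EG EP EM G P M} {A : Connection B}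

theorem Connection.IsPathLift.arrow_eq {x y y' : M} {p q q' : P} {c : PwPath EM x y}
    {c' : PwPath EM x y'} {γ : PwPath EP p q} {γ' : PwPath EP p q'} (h : A.IsPathLift c γ)
    (h' : A.IsPathLift c' γ')
    (hc : (BtPath.mk c).arrow = (BtPath.mk c').arrow) :
    (BtPath.mk γ).arrow = (BtPath.mk γ').arrow := by
  obtain rfl : y = y' := congrArg (fun F : Arrow (PathCat EM M) => F.right) hc
  have hmem : BtPath.mk γ ∈ A.liftClasses c' p q :=
    A.liftClasses_eq_of_mk_eq (Arrow.mk_injective _ _ hc) p q ▸ ⟨γ, h, rfl⟩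
  obtain ⟨δ, hδ, hδγ⟩ := hmem
  obtain rfl := h'.target_eq hδ (PwPath.isReparam_self c')
  rw [← hδγ, BtPath.mk_eq_of_isReparam (h'.isReparam hδ (PwPath.isReparam_self c'))]

theorem Connection.IsHorizontal.arrow_eq {p q q' : PathCat EP P} {f : p ⟶ q} {f' : p ⟶ q'}
    (hf : A.IsHorizontal f) (hf' : A.IsHorizontal f')
    (h : Arrow.mk (B.projPath.map f) = Arrow.mk (B.projPath.map f')) :
    Arrow.mk f = Arrow.mk f' := by
  obtain ⟨γ, hγ, rfl⟩ := hf
  obtain ⟨γ', hγ', rfl⟩ := hf'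
  have hproj : ContMDiff 𝓘(ℝ, EP) 𝓘(ℝ, EM) 1 B.proj :=
    B.contMDiff_proj.of_le (by exact_mod_cast le_top)
  exact (A.isPathLift_map hproj hγ).arrow_eq (A.isPathLift_map hproj hγ') h

theorem Connection.exists_isHorizontal (A : Connection B) {x y : PathCat EM M} (f : x ⟶ y) :
    ∃ (p q : PathCat EP P) (f' : p ⟶ q), A.IsHorizontal f' ∧
      Arrow.mk (B.projPath.map f') = Arrow.mk f := by
  induction f using Quotient.inductionOn with
  | h c =>
    obtain ⟨p, hp⟩ := B.proj_surjective x
    obtain ⟨q, γ, hγ⟩ := A.exists_isPathLift c hp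
    obtain rfl : B.proj p = x := hp
    obtain rfl : B.proj q = y := hγ.proj_target
    refine ⟨p, q, BtPath.mk γ, ⟨γ, hγ.isHorizontalPath, rfl⟩, ?_⟩
    exact congrArg (BtPath.arrow (E := EM) (X := M)) <| BtPath.mk_eq_of_isReparam <|
      PwPath.isReparam_of_eqOn hγ.len_eq fun t ht => hγ.isLift.proj_eq t (hγ.len_eq ▸ ht)

end UniqueArrowLift

section CrossedModule

variable {EG EH G H : Type*}
  [NormedAddCommGroup EG] [NormedSpace ℝ EG] [NormedAddCommGroup EH] [NormedSpace ℝ EH]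
  [TopologicalSpace G] [ChartedSpace EG G] [Group G]
  [TopologicalSpace H] [ChartedSpace EH H] [Group H] (X : LieCrossedModule EG EH G H)

namespace LieCrossedModule

theorem α_inv_mul_mul {a b : G} {k : H} (hb : b = X.τ k * a) (l h h' : H) :
    X.α a⁻¹ ((l * k)⁻¹ * (h' * h)) = X.α b⁻¹ (l⁻¹ * h') * X.α a⁻¹ (k⁻¹ * h) := by
  rw [hb, mul_inv_rev (X.τ k), ← map_inv X.τ, map_mul X.α, MulAut.mul_apply, X.α_τ, ← map_mul]
  congr 1
  group

theorem τ_mul_eq {a b : G} {k : H} (hb : b = X.τ k * a) (h : H) :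
    X.τ h * a = b * X.τ (X.α a⁻¹ (k⁻¹ * h)) := by
  rw [X.τ_α, hb, map_mul, map_inv]
  group

end LieCrossedModule

end CrossedModule

section Decorated

variable {EG EH EP EM G H P M : Type*}
  [NormedAddCommGroup EG] [NormedSpace ℝ EG] [NormedAddCommGroup EP] [NormedSpace ℝ EP]
  [NormedAddCommGroup EM] [NormedSpace ℝ EM] [NormedAddCommGroup EH] [NormedSpace ℝ EH]
  [TopologicalSpace G] [ChartedSpace EG G] [Group G]
  [TopologicalSpace H] [ChartedSpace EH H] [Group H]
  [TopologicalSpace P] [ChartedSpace EP P] [TopologicalSpace M] [ChartedSpace EM M]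
  [IsManifold 𝓘(ℝ, EP) ∞ P]
  {B : PrincipalBundle EG EP EM G P M} {A : Connection B} {X : LieCrossedModule EG EH G H}

namespace DecCat

/-- The decoration of a morphism of the category of decorated paths. -/
def dec (F : Arrow (DecCat A X)) : H := DecHom.h F.hom

/-- The undecorated path under a morphism of the category of decorated paths. Its target is
`F.right` translated by the decoration. -/
def pathArrow (F : Arrow (DecCat A X)) : Arrow (PathCat EP P) := Arrow.mk (DecHom.path F.hom)

theorem arrow_ext {F F' : Arrow (DecCat A X)} (hdec : dec F = dec F')
    (hpath : pathArrow F = pathArrow F') : F = F' := by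
  obtain ⟨p, q, h, f, hf⟩ := F
  obtain ⟨p', q', h', f', hf'⟩ := F'
  obtain rfl : h = h' := hdec
  obtain rfl : p = p' := congrArg (fun F : Arrow (PathCat EP P) => F.left) hpath
  obtain rfl : q = q' := B.act_left_injective (X.τ h)
    (congrArg (fun F : Arrow (PathCat EP P) => F.right) hpath)
  obtain rfl : f = f' := Arrow.mk_injective _ _ hpath
  rfl

theorem hom_ext {p q : DecCat A X} {f g : p ⟶ q} (hdec : DecHom.h f = DecHom.h g)
    (hpath : pathArrow (Arrow.mk f) = pathArrow (Arrow.mk g)) : f = g :=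
  Arrow.mk_injective _ _ (arrow_ext (F := Arrow.mk f) (F' := Arrow.mk g) hdec hpath)

theorem pathArrow_id (p : DecCat A X) : pathArrow (Arrow.mk (𝟙 p)) = Arrow.mk (𝟙 p.toPath) :=
  Arrow.arrow_mk_comp_eqToHom _ _

theorem pathArrow_comp {p q r : DecCat A X} (f : p ⟶ q) (g : q ⟶ r) :
    pathArrow (Arrow.mk (f ≫ g)) =
      Arrow.mk (DecHom.path f ≫ (B.translate (X.τ (DecHom.h f))).map (DecHom.path g)) :=
  arrow_mk_comp_congr rfl (Arrow.arrow_mk_comp_eqToHom _ _)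

end DecCat

variable (A X)

theorem arrow_mk_decProj_map {p q : DecCat A X} (f : p ⟶ q) :
    Arrow.mk ((decProj A X).map f) =
      B.projPath.mapArrow.obj (DecCat.pathArrow (Arrow.mk f)) :=
  Arrow.arrow_mk_comp_eqToHom _ _

/-- The projection of the category of decorated paths to the category of paths on the base. -/
def decProjFunctor : DecCat A X ⥤ PathCat EM M where
  __ := decProj A X
  map_id p := Arrow.mk_injective _ _ <| by
    rw [arrow_mk_decProj_map, DecCat.pathArrow_id]
    exact congrArg Arrow.mk (B.projPath.map_id _)
  map_comp f g := Arrow.mk_injective _ _ <| by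
    rw [arrow_mk_decProj_map, DecCat.pathArrow_comp]
    refine (congrArg Arrow.mk (B.projPath.map_comp _ _)).trans ?_
    exact arrow_mk_comp_congr (arrow_mk_decProj_map A X f).symm
      ((B.mapArrow_projPath_translate _ _).trans (arrow_mk_decProj_map A X g).symm)

theorem pathArrow_decAct_map {x y : DecCat A X × X.Cat} (f : x ⟶ y) :
    DecCat.pathArrow (Arrow.mk ((decAct A X).map f)) =
      (B.translate x.2.toGroup).mapArrow.obj (DecCat.pathArrow (Arrow.mk f.1)) :=
  Arrow.arrow_mk_comp_eqToHom _ _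

/-- The right action of the categorical group on the category of decorated paths. -/
def decActFunctor : DecCat A X × X.Cat ⥤ DecCat A X where
  __ := decAct A X
  map_id x := by
    refine DecCat.hom_ext ?_ ?_
    · change X.α x.2.toGroup⁻¹ (1⁻¹ * 1) = 1
      rw [inv_one, one_mul, map_one]
    · rw [pathArrow_decAct_map]
      refine (congrArg (B.translate x.2.toGroup).mapArrow.obj (DecCat.pathArrow_id x.1)).trans ?_
      exact (congrArg Arrow.mk ((B.translate x.2.toGroup).map_id _)).trans
        (DecCat.pathArrow_id _).symm
  map_comp {x y z} f g := by
    have hy : y.2.toGroup = X.τ f.2.1 * x.2.toGroup := f.2.2.symm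
    refine DecCat.hom_ext (X.α_inv_mul_mul hy _ _ _) ?_
    rw [pathArrow_decAct_map, DecCat.pathArrow_comp]
    refine (congrArg (B.translate x.2.toGroup).mapArrow.obj
      (DecCat.pathArrow_comp f.1 g.1)).trans ?_
    refine (congrArg Arrow.mk ((B.translate x.2.toGroup).map_comp _ _)).trans ?_
    refine arrow_mk_comp_congr (pathArrow_decAct_map A X f).symm ?_
    let γ := DecCat.pathArrow (Arrow.mk g.1)
    let h := X.τ (DecHom.h ((decAct A X).map f))
    calc (B.translate x.2.toGroup).mapArrow.obj ((B.translate (X.τ (DecHom.h f.1))).mapArrow.obj γ)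
      _ = (B.translate (X.τ (DecHom.h f.1) * x.2.toGroup)).mapArrow.obj γ :=
        B.mapArrow_translate_translate _ _ _
      _ = (B.translate (y.2.toGroup * h)).mapArrow.obj γ := by
        rw [X.τ_mul_eq hy]
        rfl
      _ = (B.translate h).mapArrow.obj ((B.translate y.2.toGroup).mapArrow.obj γ) :=
        (B.mapArrow_translate_translate _ _ _).symm
      _ = (B.translate h).mapArrow.obj (DecCat.pathArrow (Arrow.mk ((decAct A X).map g))) :=
        congrArg _ (pathArrow_decAct_map A X g).symm

variable {A X}

theorem dec_actMor (F : Arrow (DecCat A X)) (φ : Arrow X.Cat) :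
    DecCat.dec (actMor (decActFunctor A X) F φ) =
      X.α φ.left.toGroup⁻¹ (φ.hom.1⁻¹ * DecCat.dec F) := rfl

theorem pathArrow_actMor (F : Arrow (DecCat A X)) (φ : Arrow X.Cat) :
    DecCat.pathArrow (actMor (decActFunctor A X) F φ) =
      (B.translate φ.left.toGroup).mapArrow.obj (DecCat.pathArrow F) :=
  pathArrow_decAct_map A X _

theorem mapArrow_decProjFunctor (F : Arrow (DecCat A X)) :
    (decProjFunctor A X).mapArrow.obj F = B.projPath.mapArrow.obj (DecCat.pathArrow F) :=
  arrow_mk_decProj_map A X F.hom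

theorem eq_one_of_actMor_eq {F : Arrow (DecCat A X)} {φ : Arrow X.Cat}
    (h : actMor (decActFunctor A X) F φ = F) : φ = 1 := by
  have hdec := (dec_actMor F φ).symm.trans (congrArg DecCat.dec h)
  obtain ⟨a, b, k, hk⟩ := φ
  obtain rfl : a = 1 := B.act_free F.left a (congrArg (fun F : Arrow (DecCat A X) => F.left) h)
  refine X.arrow_ext rfl ?_
  change X.α (1 : G)⁻¹ (k⁻¹ * DecCat.dec F) = DecCat.dec F at hdec
  change k = 1
  simpa only [inv_one, map_one, MulAut.one_apply, mul_eq_right, inv_eq_one] using hdec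

variable (A X) in
theorem isRightAction_decActFunctor : IsRightAction (decActFunctor A X) where
  obj_one p := B.act_one p
  obj_mul p a b := B.act_mul p a.toGroup b.toGroup
  mor_one F := by
    refine DecCat.arrow_ext ?_ ((pathArrow_actMor F 1).trans (B.mapArrow_translate_one _))
    rw [dec_actMor]
    change X.α (1 : G)⁻¹ ((1 : H)⁻¹ * DecCat.dec F) = DecCat.dec F
    simp only [inv_one, map_one, one_mul, MulAut.one_apply]
  mor_mul F φ ψ := by
    refine DecCat.arrow_ext ?_ ?_
    · rw [dec_actMor, dec_actMor, dec_actMor]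
      change X.α ψ.left.toGroup⁻¹
          (ψ.hom.1⁻¹ * X.α φ.left.toGroup⁻¹ (φ.hom.1⁻¹ * DecCat.dec F)) =
        X.α (φ.left.toGroup * ψ.left.toGroup)⁻¹
          ((φ.hom.1 * X.α φ.left.toGroup ψ.hom.1)⁻¹ * DecCat.dec F)
      simp [mul_assoc]
    · rw [pathArrow_actMor, pathArrow_actMor, pathArrow_actMor]
      exact B.mapArrow_translate_translate _ _ _

variable [LieGroup 𝓘(ℝ, EG) ∞ G] [CompleteSpace EG]

variable (A X) in
theorem decProjFunctor_mapArrow_surjective :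
    Function.Surjective (decProjFunctor A X).mapArrow.obj := by
  rintro ⟨x, y, f⟩
  obtain ⟨p, q, f', hf', hproj⟩ := A.exists_isHorizontal f
  -- Decorating with `1` leaves the target of the path unchanged.
  let F : DecHom (A := A) (X := X) p q :=
    { h := 1
      path := f' ≫ eqToHom (by rw [map_one, translate_obj_one]; rfl)
      horizontal := hf'.eqToHom A _ }
  refine ⟨Arrow.mk (X := (p : DecCat A X)) (Y := (q : DecCat A X)) F, ?_⟩
  rw [mapArrow_decProjFunctor]
  exact (congrArg B.projPath.mapArrow.obj (Arrow.arrow_mk_comp_eqToHom _ _)).trans hproj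

theorem exists_actMor_eq {F F' : Arrow (DecCat A X)}
    (h : (decProjFunctor A X).mapArrow.obj F = (decProjFunctor A X).mapArrow.obj F') :
    ∃ φ : Arrow X.Cat, actMor (decActFunctor A X) F φ = F' := by
  rw [mapArrow_decProjFunctor, mapArrow_decProjFunctor] at h
  obtain ⟨p, q, k, f, hf⟩ := F
  obtain ⟨p', q', k', f', hf'⟩ := F'
  obtain ⟨a, rfl⟩ := B.exists_act_eq
    (congrArg (fun F : Arrow (PathCat EM M) => F.left) h : B.proj p = B.proj p')
  -- The decoration `k' = α(a⁻¹)(l⁻¹ k)` determines `l`.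
  let l := k * (X.α a k')⁻¹
  refine ⟨Arrow.mk (X := (a : X.Cat)) (Y := (X.τ l * a : G)) ⟨l, rfl⟩, DecCat.arrow_ext ?_ ?_⟩
  · refine (dec_actMor _ _).trans ?_
    change X.α a⁻¹ ((k * (X.α a k')⁻¹)⁻¹ * k) = k'
    simp
  · refine (pathArrow_actMor _ _).trans ?_
    exact (hf.translate A a).arrow_eq hf' ((B.mapArrow_projPath_translate _ a).trans h)

variable (A X) in
theorem isPrincipalCategoricalBundle_decActFunctor :
    IsPrincipalCategoricalBundle (decProjFunctor A X) (decActFunctor A X) where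
  rightAction := isRightAction_decActFunctor A X
  obj_surjective := B.proj_surjective
  mor_surjective := decProjFunctor_mapArrow_surjective A X
  obj_free p a h := B.act_free p a h
  mor_free _ _ h := eq_one_of_actMor_eq h
  obj_fiber p a := B.proj_act p a
  mor_fiber F φ := by
    rw [mapArrow_decProjFunctor, mapArrow_decProjFunctor, pathArrow_actMor,
      B.mapArrow_projPath_translate]
  obj_transitive _ _ h := B.exists_act_eq h
  mor_transitive _ _ h := exists_actMor_eq h

end Decorated

end CatBundle

end

theorem theoremT_general {EG EH EP EM G H P M : Type*}
    [NormedAddCommGroup EG] [NormedSpace ℝ EG] [CompleteSpace EG]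
    [NormedAddCommGroup EH] [NormedSpace ℝ EH]
    [NormedAddCommGroup EP] [NormedSpace ℝ EP]
    [NormedAddCommGroup EM] [NormedSpace ℝ EM]
    [TopologicalSpace G] [ChartedSpace EG G] [Group G] [LieGroup 𝓘(ℝ, EG) ∞ G]
    [TopologicalSpace H] [ChartedSpace EH H] [Group H]
    [TopologicalSpace P] [ChartedSpace EP P] [IsManifold 𝓘(ℝ, EP) ∞ P]
    [TopologicalSpace M] [ChartedSpace EM M]
    (X : CatBundle.LieCrossedModule EG EH G H)
    (B : CatBundle.PrincipalBundle EG EP EM G P M)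
    (A : CatBundle.Connection B) :
    ∃ (π : CatBundle.DecCat A X ⥤ CatBundle.PathCat EM M)
      (ρ : CatBundle.DecCat A X × X.Cat ⥤ CatBundle.DecCat A X),
      π.toPrefunctor = CatBundle.decProj A X ∧
      ρ.toPrefunctor = CatBundle.decAct A X ∧
      CatBundle.IsPrincipalCategoricalBundle π ρ :=
  ⟨CatBundle.decProjFunctor A X, CatBundle.decActFunctor A X, rfl, rfl,
    CatBundle.isPrincipalCategoricalBundle_decActFunctor A X⟩

theorem theoremT {EG EH EP EM G H P M : Type*}
    [NormedAddCommGroup EG] [NormedSpace ℝ EG] [FiniteDimensional ℝ EG]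
    [NormedAddCommGroup EH] [NormedSpace ℝ EH] [FiniteDimensional ℝ EH]
    [NormedAddCommGroup EP] [NormedSpace ℝ EP] [FiniteDimensional ℝ EP]
    [NormedAddCommGroup EM] [NormedSpace ℝ EM] [FiniteDimensional ℝ EM]
    [TopologicalSpace G] [ChartedSpace EG G] [Group G] [LieGroup 𝓘(ℝ, EG) ∞ G] [T2Space G]
    [TopologicalSpace H] [ChartedSpace EH H] [Group H] [LieGroup 𝓘(ℝ, EH) ∞ H] [T2Space H]
    [TopologicalSpace P] [ChartedSpace EP P] [IsManifold 𝓘(ℝ, EP) ∞ P] [T2Space P]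
    [TopologicalSpace M] [ChartedSpace EM M] [IsManifold 𝓘(ℝ, EM) ∞ M] [T2Space M]
    (X : CatBundle.LieCrossedModule EG EH G H)
    (B : CatBundle.PrincipalBundle EG EP EM G P M)
    (A : CatBundle.Connection B) :
    ∃ (π : CatBundle.DecCat A X ⥤ CatBundle.PathCat EM M)
      (ρ : CatBundle.DecCat A X × X.Cat ⥤ CatBundle.DecCat A X),
      π.toPrefunctor = CatBundle.decProj A X ∧
      ρ.toPrefunctor = CatBundle.decAct A X ∧
      CatBundle.IsPrincipalCategoricalBundle π ρ := by
  have := FiniteDimensional.complete ℝ EG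
  exact theoremT_general X B A
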